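/- Let $\mathbb D=\{z\in\mathbb C:|z|<1\}$. For a domain $D\subset\mathbb C$ and $p\in D$ put $$M_D(p)=\sup\bigl\{\|df_0\| : f:\mathbb D\to D \text{ harmonic},\ f(0)=p,\ df_0 \text{ conformal}\bigr\},$$ where $\|df_0\|$ is the operator norm of the real differential $df_0:\mathbb R^2\to\mathbb R^2$, and $df_0$ is called conformal if $f_{\bar z}(0)=0$ or $f_z(0)=0$ (so orientation reversing maps and $df_0=0$ are allowed). A harmonic extremal map for $(D,p)$ is a map $f$ from this family with $\|df_0\|=M_D(p)$. A bounded strongly convex domain is a bounded convex domain with $C^2$ boundary of everywhere positive curvature. Let $a,\lambda\in\mathbb C$. The polynomial $q(z)=1+az+\lambda z^2$ has no zeros on $\overline{\mathbb D}$ if and only if $$|\lambda|<1\quad\text{and}\quad |a-\bar a\lambda|<1-|\lambda|^2 .$$ Suppose that this is the case, let $c>0$, and let $F:\mathbb D\to\mathbb C$ be the (unique) holomorphic function with $F(0)=0$ and $F'(z)=c/q(z)$ for $z\in\mathbb D$. Then $F$ is a biholomorphic map of $\mathbb D$ onto $D=F(\mathbb D)$, the set $D$ is a bounded strongly convex domain,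 and $M_D(0)=|F'(0)|=c$. The harmonic extremal maps for $(D,0)$ are precisely the maps $$z\longmapsto F(e^{i\theta}z)\quad\text{and}\quad z\longmapsto F(e^{i\theta}\bar z),\qquad \theta\in\mathbb R .$$ -/

import Mathlib

open scoped ComplexConjugate

/-- The open unit disc. -/
def unitDisc : Set ℂ := Metric.ball 0 1

/-- A real-linear map of the plane is conformal if it is a (possibly orientation reversing)
similarity; as usual for the condition `f_z̄ = 0` or `f_z = 0`, the zero map is admitted. -/
def IsConformalLinear (A : ℂ →L[ℝ] ℂ) : Prop :=
  IsConformalMap A ∨ A = 0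

/-- `f` restricts to a harmonic map `𝔻 → D` with `f 0 = p` and conformal differential at `0`. -/
structure IsAdmissible (D : Set ℂ) (p : ℂ) (f : ℂ → ℂ) : Prop where
  harmonic : InnerProductSpace.HarmonicOnNhd f unitDisc
  mapsTo : Set.MapsTo f unitDisc D
  map_zero : f 0 = p
  conformal : IsConformalLinear (fderiv ℝ f 0)

/-- `M_D(p)`: the supremum of the operator norms `‖df₀‖` over all admissible `f`, taken in
`[0, ∞]` so that it is a genuine supremum in all cases. -/
noncomputable def harmonicM (D : Set ℂ) (p : ℂ) : ENNReal :=
  ⨆ (f : ℂ → ℂ) (_ : IsAdmissible D p f), ‖fderiv ℝ f 0‖ₑ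

/-- `f` is an extremal: an admissible map whose differential attains `M_D(p)`. -/
def IsHarmonicExtremal (D : Set ℂ) (p : ℂ) (f : ℂ → ℂ) : Prop :=
  IsAdmissible D p f ∧ ‖fderiv ℝ f 0‖ₑ = harmonicM D p

/-- `F` restricts to a biholomorphic map of the open set `U` onto the open set `V`. -/
def IsBiholomorphicOnto (F : ℂ → ℂ) (U V : Set ℂ) : Prop :=
  IsOpen U ∧ IsOpen V ∧ DifferentiableOn ℂ F U ∧ Set.MapsTo F U V ∧
    ∃ G : ℂ → ℂ, DifferentiableOn ℂ G V ∧ Set.MapsTo G V U ∧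
      Set.LeftInvOn G F U ∧ Set.RightInvOn G F V

/-- A bounded strongly convex domain in the plane: a bounded convex domain with `C²` boundary of
everywhere positive curvature. That is, near its boundary the domain is the sublevel set `ρ < 0` of
a `C²` function `ρ` with nonvanishing differential at the boundary points, whose second
differential is positive on the nonzero tangent vectors to the boundary. -/
structure IsBoundedStronglyConvexDomain (D : Set ℂ) : Prop where
  isOpen : IsOpen D
  nonempty : D.Nonempty
  bounded : Bornology.IsBounded D
  convex : Convex ℝ D
  boundary : ∃ (U : Set ℂ) (ρ : ℂ → ℝ), IsOpen U ∧ frontier D ⊆ U ∧ ContDiffOn ℝ 2 ρ U ∧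
    D ∩ U = {w ∈ U | ρ w < 0} ∧
    ∀ w ∈ frontier D, fderiv ℝ ρ w ≠ 0 ∧
      ∀ v : ℂ, v ≠ 0 → fderiv ℝ ρ w v = 0 → 0 < fderiv ℝ (fderiv ℝ ρ) w v v

/-- `F` is, on the unit disc, the holomorphic function with `F 0 = 0` and
`F' z = c / (1 + a z + lam z²)`. -/
def IsQuadraticPrimitive (a lam : ℂ) (c : ℝ) (F : ℂ → ℂ) : Prop :=
  F 0 = 0 ∧ ∀ z ∈ unitDisc, HasDerivAt F ((c : ℂ) / (1 + a * z + lam * z ^ 2)) z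

open Metric InnerProductSpace

/-! ### The Schur--Cohn criterion for quadratic polynomials -/

/-! Factor q(z) = (1 - αz)(1 - βz). Having no zeros on the closed disc means |α|, |β| < 1, and the
Schur–Cohn criterion becomes an inequality between |α| and |β| (`schurCohn_roots_iff`).

Extremality is a duality argument. The outer normal of D at F(ζ), |ζ| = 1, is a positive multiple of
ζF'(ζ), hence of the conjugate of ζ̄q(ζ) = ζ̄ + a + λζ. Convexity gives Re((ζ̄ + a + λζ)(F(ζ) - w))
≥ 0 for w ∈ D. Since q is quadratic, this weight has only the frequencies -1, 0, 1, so its average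
against f = h + ḡ with h(0) = g(0) = 0 sees only h'(0) and g'(0) (`circleAverage_re_mul_harmonic`).
If g'(0) = 0, taking w = f(ζ) yields Re h'(0) ≤ Re F'(0). Strong convexity replaces the bound 0 by
κ|F(ζ) - w|², so equality forces f = F (`IsSupported.eqOn_of_re_deriv_eq`). Rotations and
conjugation of the variable reduce every admissible map to this situation.

Strong convexity comes from explicit formulas: F is a Möbius map if α = β and a difference of
logarithms otherwise. In both cases c²(|z|² - 1)/|q(z)|, written in the variable w = F(z), is an
elementary function ρ with a computable Hessian (`exists_isConvexModel`). The boundary regularity,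
the convexity and the support inequality are all read off from ρ. -/

lemma exists_eq_mul_one_sub (a lam : ℂ) :
    ∃ α β : ℂ, a = -(α + β) ∧ lam = α * β := by
  obtain ⟨s, hs⟩ := IsAlgClosed.exists_pow_nat_eq (a ^ 2 - 4 * lam) (n := 2) (by norm_num)
  exact ⟨(-a + s) / 2, (-a - s) / 2, by ring, by linear_combination (1 / 4) * hs⟩

lemma forall_one_sub_mul_ne_zero_iff (α β : ℂ) :
    (∀ z : ℂ, ‖z‖ ≤ 1 → (1 - α * z) * (1 - β * z) ≠ 0) ↔ ‖α‖ < 1 ∧ ‖β‖ < 1 := by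
  have key : ∀ γ : ℂ, 1 ≤ ‖γ‖ → ‖γ⁻¹‖ ≤ 1 ∧ 1 - γ * γ⁻¹ = 0 := fun γ hγ => by
    have h0 : γ ≠ 0 := fun h => by simp [h] at hγ; linarith
    exact ⟨by rw [norm_inv]; exact inv_le_one_of_one_le₀ hγ, by simp [h0]⟩
  have ne : ∀ γ z : ℂ, ‖γ‖ < 1 → ‖z‖ ≤ 1 → 1 - γ * z ≠ 0 := fun γ z hγ hz h => by
    have h1 : ‖γ * z‖ = 1 := by rw [← sub_eq_zero.1 h]; simp
    rw [norm_mul] at h1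
    nlinarith [norm_nonneg γ, norm_nonneg z]
  constructor
  · intro h
    constructor
    · by_contra! hα
      exact h _ (key α hα).1 (by rw [(key α hα).2, zero_mul])
    · by_contra! hβ
      exact h _ (key β hβ).1 (by rw [(key β hβ).2, mul_zero])
  · rintro ⟨hα, hβ⟩ z hz
    exact mul_ne_zero (ne α z hα hz) (ne β z hβ hz)

/-- The left side of the second inequality is |α(1 - |β|²) + β(1 - |α|²)|. With x = |α|, y = |β|,
the triangle inequality and its reverse compare it with (x + y)(1 - xy), and (1 - xy)(1 + xy) - (x +
y)(1 - xy) = (1 - x)(1 - y)(1 - xy). -/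
lemma schurCohn_roots_iff (α β : ℂ) :
    (‖α‖ < 1 ∧ ‖β‖ < 1) ↔ (‖α * β‖ < 1 ∧
      ‖-(α + β) - conj (-(α + β)) * (α * β)‖ < 1 - ‖α * β‖ ^ 2) := by
  have e : -(α + β) - conj (-(α + β)) * (α * β)
      = -(α * ((1 - ‖β‖ ^ 2 : ℝ) : ℂ) + β * ((1 - ‖α‖ ^ 2 : ℝ) : ℂ)) := by
    have h1 := Complex.mul_conj' α
    have h2 := Complex.mul_conj' β
    push_cast
    rw [← h1, ← h2]
    simp only [map_neg, map_add]
    ring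
  rw [e, norm_neg, norm_mul]
  have hx := norm_nonneg α
  have hy := norm_nonneg β
  have n1 : ‖α * ((1 - ‖β‖ ^ 2 : ℝ) : ℂ)‖ = ‖α‖ * |1 - ‖β‖ ^ 2| := by simp [-Complex.ofReal_sub]
  have n2 : ‖β * ((1 - ‖α‖ ^ 2 : ℝ) : ℂ)‖ = ‖β‖ * |1 - ‖α‖ ^ 2| := by simp [-Complex.ofReal_sub]
  have up := norm_add_le (α * ((1 - ‖β‖ ^ 2 : ℝ) : ℂ)) (β * ((1 - ‖α‖ ^ 2 : ℝ) : ℂ))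
  have lo := norm_sub_le (α * ((1 - ‖β‖ ^ 2 : ℝ) : ℂ) + β * ((1 - ‖α‖ ^ 2 : ℝ) : ℂ))
    (β * ((1 - ‖α‖ ^ 2 : ℝ) : ℂ))
  have lo' := norm_sub_le (α * ((1 - ‖β‖ ^ 2 : ℝ) : ℂ) + β * ((1 - ‖α‖ ^ 2 : ℝ) : ℂ))
    (α * ((1 - ‖β‖ ^ 2 : ℝ) : ℂ))
  rw [add_sub_cancel_right] at lo
  rw [add_sub_cancel_left] at lo'
  rw [n1, n2] at up lo lo'
  set N := ‖α * ((1 - ‖β‖ ^ 2 : ℝ) : ℂ) + β * ((1 - ‖α‖ ^ 2 : ℝ) : ℂ)‖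
  set x := ‖α‖
  set y := ‖β‖
  constructor
  · rintro ⟨h1, h2⟩
    rw [abs_of_nonneg (by nlinarith), abs_of_nonneg (by nlinarith)] at up
    have hxy : x * y < 1 := by nlinarith
    refine ⟨hxy, up.trans_lt ?_⟩
    nlinarith [mul_pos (mul_pos (sub_pos.2 h1) (sub_pos.2 h2)) (sub_pos.2 hxy)]
  · rintro ⟨hxy, h⟩
    -- If s ≥ 1 then t < 1, and the reverse triangle inequality gives N ≥ (s + t)(1 - st) ≥ 1 -
    -- (st)².
    have aux : ∀ s t : ℝ, 0 ≤ s → 0 ≤ t → s * t < 1 → 1 ≤ s →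
        s * |1 - t ^ 2| ≤ N + t * |1 - s ^ 2| → N < 1 - (s * t) ^ 2 → False := by
      intro s t hs ht hst h1 h2 h3
      have ht1 : t < 1 := by nlinarith
      rw [abs_of_nonneg (by nlinarith), abs_of_nonpos (by nlinarith)] at h2
      nlinarith [mul_nonneg (mul_nonneg (sub_nonneg.2 h1) (sub_pos.2 ht1).le) (sub_pos.2 hst).le]
    constructor <;> by_contra! hc
    · exact aux x y hx hy hxy hc lo h
    · exact aux y x hy hx (by rwa [mul_comm]) hc lo' (by rwa [mul_comm y x])

/-! ### Second order convexity along segments -/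

section Convexity

variable {ρ : ℂ → ℝ} (hρ : ContDiff ℝ 2 ρ)
include hρ

lemma ContDiff.hasDerivAt_line (p v : ℂ) (t : ℝ) :
    HasDerivAt (fun t : ℝ => ρ (p + t • v)) (fderiv ℝ ρ (p + t • v) v) t := by
  have h1 : HasDerivAt (fun t : ℝ => p + t • v) v t := by
    simpa using ((hasDerivAt_id t).smul_const v).const_add p
  exact ((hρ.differentiable (by norm_num)) _).hasFDerivAt.comp_hasDerivAt t h1

lemma ContDiff.hasDerivAt_fderiv_line (p v : ℂ) (t : ℝ) :
    HasDerivAt (fun t : ℝ => fderiv ℝ ρ (p + t • v) v)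
      (fderiv ℝ (fderiv ℝ ρ) (p + t • v) v v) t := by
  have h1 : HasDerivAt (fun t : ℝ => p + t • v) v t := by
    simpa using ((hasDerivAt_id t).smul_const v).const_add p
  have h2 : Differentiable ℝ (fderiv ℝ ρ) :=
    (hρ.fderiv_right (m := 1) (by norm_num)).differentiable (by norm_num)
  have h3 := (h2 (p + t • v)).hasFDerivAt.comp_hasDerivAt t h1
  exact h3.clm_apply (hasDerivAt_const t v) |>.congr_deriv (by simp)

lemma ContDiff.fderiv_fderiv_eq_of_line {φ : ℝ → ℝ} {p v : ℂ} {s : ℝ}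
    (h1 : ∀ t, HasDerivAt (fun t : ℝ => ρ (p + t • v)) (φ t) t) (h2 : HasDerivAt φ s 0) :
    fderiv ℝ (fderiv ℝ ρ) p v v = s := by
  have e : φ = fun t : ℝ => fderiv ℝ ρ (p + t • v) v :=
    funext fun t => (h1 t).unique (hρ.hasDerivAt_line p v t)
  have h3 := hρ.hasDerivAt_fderiv_line p v 0
  rw [← e] at h3
  simpa using h3.unique h2

/-- Taylor's inequality by two monotonicity arguments on [0, 1]; the Hessian is controlled only
along the segment. -/
lemma ContDiff.tangent_le {κ : ℝ} {p v : ℂ}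
    (h : ∀ t ∈ Set.Icc (0 : ℝ) 1, κ * ‖v‖ ^ 2 ≤ fderiv ℝ (fderiv ℝ ρ) (p + t • v) v v) :
    ρ p + fderiv ℝ ρ p v + κ / 2 * ‖v‖ ^ 2 ≤ ρ (p + v) := by
  have d2 : ∀ t : ℝ, HasDerivAt
      (fun t : ℝ => fderiv ℝ ρ (p + t • v) v - fderiv ℝ ρ p v - κ * ‖v‖ ^ 2 * t)
      (fderiv ℝ (fderiv ℝ ρ) (p + t • v) v v - κ * ‖v‖ ^ 2) t := fun t => by
    exact (((hρ.hasDerivAt_fderiv_line p v t).sub_const (fderiv ℝ ρ p v)).sub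
      ((hasDerivAt_id t).const_mul (κ * ‖v‖ ^ 2))).congr_deriv (by ring)
  have d1 : ∀ t : ℝ, HasDerivAt
      (fun t : ℝ => ρ (p + t • v) - fderiv ℝ ρ p v * t - κ / 2 * ‖v‖ ^ 2 * t ^ 2)
      (fderiv ℝ ρ (p + t • v) v - fderiv ℝ ρ p v - κ * ‖v‖ ^ 2 * t) t := fun t => by
    exact (((hρ.hasDerivAt_line p v t).sub
      ((hasDerivAt_id t).const_mul (fderiv ℝ ρ p v))).sub
      ((hasDerivAt_pow 2 t).const_mul (κ / 2 * ‖v‖ ^ 2))).congr_deriv (by push_cast; ring)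
  have m2 : MonotoneOn
      (fun t : ℝ => fderiv ℝ ρ (p + t • v) v - fderiv ℝ ρ p v - κ * ‖v‖ ^ 2 * t)
      (Set.Icc 0 1) := by
    refine monotoneOn_of_deriv_nonneg (convex_Icc 0 1)
      (fun t _ => (d2 t).continuousAt.continuousWithinAt)
      (fun t _ => (d2 t).differentiableAt.differentiableWithinAt) fun t ht => ?_
    rw [(d2 t).deriv]
    exact sub_nonneg.2 (h t (interior_subset ht))
  have m1 : MonotoneOn
      (fun t : ℝ => ρ (p + t • v) - fderiv ℝ ρ p v * t - κ / 2 * ‖v‖ ^ 2 * t ^ 2)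
      (Set.Icc 0 1) := by
    refine monotoneOn_of_deriv_nonneg (convex_Icc 0 1)
      (fun t _ => (d1 t).continuousAt.continuousWithinAt)
      (fun t _ => (d1 t).differentiableAt.differentiableWithinAt) fun t ht => ?_
    rw [(d1 t).deriv]
    have ht' := interior_subset ht
    simpa using m2 (Set.left_mem_Icc.2 zero_le_one) ht' ht'.1
  have := m1 (Set.left_mem_Icc.2 zero_le_one) (Set.right_mem_Icc.2 zero_le_one) zero_le_one
  simp at this
  linarith

/-- The graph lies above its tangent plane at the convex combination p; in the weighted sum of the
two tangent inequalities the linear terms cancel. -/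
lemma ContDiff.convexOn_of_fderiv_fderiv_nonneg {V : Set ℂ} (hV : Convex ℝ V)
    (h : ∀ w ∈ V, ∀ v, 0 ≤ fderiv ℝ (fderiv ℝ ρ) w v v) : ConvexOn ℝ V ρ := by
  have tan : ∀ p ∈ V, ∀ w ∈ V, ρ p + fderiv ℝ ρ p (w - p) ≤ ρ w := by
    intro p hp w hw
    have := hρ.tangent_le (κ := 0) (p := p) (v := w - p) fun t ht => by
      rw [zero_mul]
      exact h _ (hV.add_smul_sub_mem hp hw ht) _
    simpa using this
  refine ⟨hV, fun x hx y hy s t hs ht hst => ?_⟩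
  have hp := hV hx hy hs ht hst
  have h1 := tan _ hp x hx
  have h2 := tan _ hp y hy
  set p := s • x + t • y
  have h3 : s * fderiv ℝ ρ p (x - p) + t * fderiv ℝ ρ p (y - p) = 0 := by
    rw [← smul_eq_mul, ← smul_eq_mul, ← map_smul, ← map_smul, ← map_add]
    have : s • (x - p) + t • (y - p) = 0 := by
      rw [smul_sub, smul_sub, sub_add_sub_comm, ← add_smul, hst, one_smul, sub_self]
    rw [this, map_zero]
  simp only [smul_eq_mul]
  nlinarith [mul_le_mul_of_nonneg_left h1 hs, mul_le_mul_of_nonneg_left h2 ht,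
    congrArg (· * ρ p) hst]

end Convexity

/-! ### Planar harmonic maps -/

/-- If Re f = Re H and Im f = Re K with H, K holomorphic, then f = (H + iK)/2 plus the conjugate of
(H - iK)/2. Subtracting the values at 0 is harmless because their contributions add up to f(0) = 0.
-/
lemma InnerProductSpace.HarmonicOnNhd.exists_add_conj {f : ℂ → ℂ}
    (hf : HarmonicOnNhd f (ball 0 1)) (h0 : f 0 = 0) :
    ∃ h g : ℂ → ℂ, DifferentiableOn ℂ h (ball 0 1) ∧ DifferentiableOn ℂ g (ball 0 1) ∧
      h 0 = 0 ∧ g 0 = 0 ∧ ∀ z ∈ ball (0 : ℂ) 1, f z = h z + conj (g z) := by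
  obtain ⟨H, hH, hHf⟩ := (hf.comp_CLM Complex.reCLM).exists_analyticOnNhd_ball_re_eq
  obtain ⟨K, hK, hKf⟩ := (hf.comp_CLM Complex.imCLM).exists_analyticOnNhd_ball_re_eq
  have hmem : (0 : ℂ) ∈ ball (0 : ℂ) 1 := mem_ball_self one_pos
  have hf' : ∀ z ∈ ball (0 : ℂ) 1, f z = (H z + Complex.I * K z) / 2
      + conj ((H z - Complex.I * K z) / 2) := by
    intro z hz
    have h1 : (H z).re = (f z).re := hHf hz
    have h2 : (K z).re = (f z).im := hKf hz
    apply Complex.ext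
    · rw [Complex.add_re, Complex.conj_re, ← h1]
      simp
      ring
    · rw [Complex.add_im, Complex.conj_im, ← h2]
      simp
      ring
  have dH := hH.differentiableOn
  have dK := hK.differentiableOn
  refine ⟨fun z => (H z + Complex.I * K z) / 2 - (H 0 + Complex.I * K 0) / 2,
    fun z => (H z - Complex.I * K z) / 2 - (H 0 - Complex.I * K 0) / 2,
    by fun_prop, by fun_prop, by simp, by simp, fun z hz => ?_⟩
  rw [hf' z hz, map_sub]
  have := hf' 0 hmem
  rw [h0] at this
  linear_combination -this

lemma circleAverage_re_of_differentiableOn {K : ℂ → ℂ} {R : ℝ} (hR : 1 < R)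
    (hK : DifferentiableOn ℂ K (ball 0 R)) :
    Real.circleAverage (fun z => (K z).re) 0 1 = (K 0).re := by
  have hsub : closedBall (0 : ℂ) 1 ⊆ ball 0 R := closedBall_subset_ball hR
  have hc : CircleIntegrable K 0 1 :=
    (hK.continuousOn.mono (sphere_subset_closedBall.trans hsub)).circleIntegrable zero_le_one
  have h1 : Real.circleAverage K 0 1 = K 0 := by
    apply DiffContOnCl.circleAverage
    apply DifferentiableOn.diffContOnCl
    apply hK.mono
    rw [abs_one, closure_ball _ one_ne_zero]
    exact hsub
  rw [← h1]
  exact Complex.reCLM.circleAverage_comp_comm hc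

/-- The average of `Re ((ζ̄ + a + λ ζ) f ζ)` over the unit circle, for `f = h + ḡ`. -/
lemma circleAverage_re_mul_harmonic (a lam : ℂ) {h g : ℂ → ℂ} {R : ℝ} (hR : 1 < R)
    (hh : DifferentiableOn ℂ h (ball 0 R)) (hg : DifferentiableOn ℂ g (ball 0 R))
    (h0 : h 0 = 0) (g0 : g 0 = 0) :
    Real.circleAverage (fun z => ((conj z + a + lam * z) * (h z + conj (g z))).re) 0 1
      = (deriv h 0 + conj lam * deriv g 0).re := by
  -- On the circle z̄ = 1/z. The terms carrying z̄, namely z̄h and, after conjugating the ḡ part,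
  -- λ̄z̄g, combine to m(z)/z, which extends holomorphically with value m'(0) at 0. All other terms
  -- vanish at 0, so the mean value property finishes.
  set m : ℂ → ℂ := fun z => h z + conj lam * g z with hm
  have hnhds : ball (0 : ℂ) R ∈ nhds 0 := ball_mem_nhds _ (by linarith)
  have dm : DifferentiableOn ℂ m (ball 0 R) := by fun_prop
  have ddm : DifferentiableOn ℂ (dslope m 0) (ball 0 R) :=
    (Complex.differentiableOn_dslope hnhds).2 dm
  have key : Real.circleAverage (fun z => (dslope m 0 z + (a + lam * z) * h z
      + (z + conj a) * g z).re) 0 1 = (deriv h 0 + conj lam * deriv g 0).re := by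
    rw [circleAverage_re_of_differentiableOn hR (K := fun z => dslope m 0 z + (a + lam * z) * h z
      + (z + conj a) * g z) (by fun_prop)]
    have := ((hh.differentiableAt hnhds).hasDerivAt.add
      ((hg.differentiableAt hnhds).hasDerivAt.const_mul (conj lam))).deriv
    rw [dslope_same, h0, g0, mul_zero, mul_zero, add_zero, add_zero, ← this]
    rfl
  rw [← key]
  refine Real.circleAverage_congr_sphere fun z hz => ?_
  have hz1 : ‖z‖ = 1 := by simpa using hz
  have hzne : z ≠ 0 := fun h => by simp [h] at hz1
  have hzz : z * conj z = 1 := by rw [Complex.mul_conj', hz1]; simp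
  have hd : dslope m 0 z = conj z * m z := by
    rw [dslope_of_ne _ hzne, slope_def_field, hm]
    simp only [h0, g0, mul_zero, add_zero, sub_zero]
    rw [div_eq_iff hzne]
    linear_combination -(h z + conj lam * g z) * hzz
  have e : (conj z + a + lam * z) * (h z + conj (g z))
      = (conj z + a + lam * z) * h z + conj ((z + conj a + conj lam * conj z) * g z) := by
    simp only [map_mul, map_add, Complex.conj_conj]
    ring
  rw [e, hd, hm, Complex.add_re, Complex.conj_re, ← Complex.add_re]
  congr 1
  ring

/-- `|u|²` is subharmonic: it is at most a multiple of its average over the circle. -/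
lemma InnerProductSpace.HarmonicOnNhd.norm_sq_le_circleAverage {u : ℂ → ℂ}
    (hu : HarmonicOnNhd u (closedBall 0 1)) {w : ℂ} (hw : w ∈ ball (0 : ℂ) 1) :
    ‖u w‖ ^ 2 ≤ (1 + ‖w‖) / (1 - ‖w‖) * Real.circleAverage (fun z => ‖u z‖ ^ 2) 0 1 := by
  have hw1 : ‖w‖ < 1 := by simpa using hw
  set b := u w with hb
  -- A harmonic minorant of |u|² touching it at w, because |u - b|² ≥ 0; its Poisson formula at w
  -- then uses only the upper bound for the kernel.
  set v : ℂ → ℝ := fun z => 2 * (conj b * u z).re - ‖b‖ ^ 2 with hv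
  have harm : HarmonicOnNhd v (closedBall 0 1) := by
    have h1 := (hu.comp_CLM ((2 : ℝ) • Complex.reCLM ∘L
      ((ContinuousLinearMap.mul ℂ ℂ (conj b)).restrictScalars ℝ))).sub
      (harmonicOnNhd_const (‖b‖ ^ 2) (s := closedBall (0 : ℂ) 1))
    exact h1
  have hP := harm.circleAverage_poissonKernel_smul hw
  have hval : v w = ‖b‖ ^ 2 := by
    simp only [hv, ← hb]
    rw [Complex.conj_mul', ← Complex.ofReal_pow, Complex.ofReal_re]
    ring
  have hcu : ContinuousOn u (closedBall 0 1) := hu.continuousOn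
  have hcs := hcu.mono (sphere_subset_closedBall)
  rw [hval] at hP
  rw [← hP, ← smul_eq_mul, ← Real.circleAverage_fun_smul]
  have hne : ∀ z ∈ sphere (0 : ℂ) 1, ‖z - 0 - (w - 0)‖ ^ 2 ≠ 0 := fun z hz h => by
    have hz1 : ‖z‖ = 1 := by simpa using hz
    have : z = w := by simpa [sub_eq_zero] using h
    rw [this] at hz1
    linarith
  refine Real.circleAverage_mono ?_ ?_ fun z hz => ?_
  · refine ContinuousOn.circleIntegrable zero_le_one ?_
    refine ContinuousOn.smul (ContinuousOn.div (by fun_prop) (by fun_prop) hne) ?_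
    exact harm.continuousOn.mono sphere_subset_closedBall
  · refine ContinuousOn.circleIntegrable zero_le_one ?_
    fun_prop
  · rw [abs_one] at hz
    have h1 : poissonKernel 0 w z ≤ (1 + ‖w‖) / (1 - ‖w‖) := by
      rw [poissonKernel_eq_re_herglotzRieszKernel]
      simpa [herglotzRieszKernel_def] using re_herglotzRieszKernel_le hz hw
    have h2 : 0 ≤ poissonKernel 0 w z := by
      have hz1 : ‖z‖ = 1 := by simpa using hz
      rw [poissonKernel_def, sub_zero, sub_zero, hz1]
      refine div_nonneg ?_ (sq_nonneg _)
      nlinarith [norm_nonneg w]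
    have h3 : v z ≤ ‖u z‖ ^ 2 := by
      have h4 : (conj b * u z).re ≤ ‖b‖ * ‖u z‖ :=
        (Complex.re_le_norm _).trans (by rw [norm_mul, Complex.norm_conj])
      simp only [hv]
      nlinarith [sq_nonneg (‖b‖ - ‖u z‖)]
    simp only [Pi.smul_apply', smul_eq_mul]
    exact (mul_le_mul_of_nonneg_left h3 h2).trans (mul_le_mul_of_nonneg_right h1 (sq_nonneg _))

lemma harmonicOnNhd_add_conj {h g : ℂ → ℂ} {s : Set ℂ} (hs : IsOpen s)
    (hh : DifferentiableOn ℂ h s) (hg : DifferentiableOn ℂ g s) :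
    HarmonicOnNhd (fun z => h z + conj (g z)) s := fun _ hz =>
  ((hh.analyticAt (hs.mem_nhds hz)).harmonicAt).add
    ((hg.analyticAt (hs.mem_nhds hz)).harmonicAt_conj)

/-! ### The extremal inequality and its equality case. -/

section Extremal

variable {a lam : ℂ} {c κ R : ℝ} {F : ℂ → ℂ} {D : Set ℂ}

/-- The support inequality: `ζ + ā + λ̄ ζ̄` is an outer normal of `D` at `F ζ`, uniformly strictly
in the sense of strong convexity. -/
def IsSupported (a lam : ℂ) (κ : ℝ) (F : ℂ → ℂ) (D : Set ℂ) : Prop :=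
  ∀ z w : ℂ, ‖z‖ = 1 → w ∈ D →
    κ * ‖F z - w‖ ^ 2 ≤ ((conj z + a + lam * z) * (F z - w)).re

/-- Average the support inequality with w = f(z) over the circle; `circleAverage_re_mul_harmonic`,
applied to F - f, evaluates the right side, and g'(0) = 0 removes the λ̄ term. -/
lemma IsSupported.circleAverage_norm_sq_le (hS : IsSupported a lam κ F D) (hR : 1 < R)
    (hF : DifferentiableOn ℂ F (ball 0 R)) (hF0 : F 0 = 0) {h g : ℂ → ℂ}
    (hh : DifferentiableOn ℂ h (ball 0 R)) (hg : DifferentiableOn ℂ g (ball 0 R))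
    (h0 : h 0 = 0) (g0 : g 0 = 0) (hg' : deriv g 0 = 0)
    (hmaps : ∀ z, ‖z‖ = 1 → h z + conj (g z) ∈ D) :
    κ * Real.circleAverage (fun z => ‖F z - (h z + conj (g z))‖ ^ 2) 0 1
      ≤ (deriv F 0 - deriv h 0).re := by
  have hnhds : ball (0 : ℂ) R ∈ nhds 0 := ball_mem_nhds _ (by linarith)
  have hsub : sphere (0 : ℂ) 1 ⊆ ball 0 R :=
    sphere_subset_closedBall.trans (closedBall_subset_ball hR)
  have h1 := circleAverage_re_mul_harmonic a lam hR (hF.sub hh) hg.neg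
    (by simp [hF0, h0]) (by simp [g0])
  have h2 : deriv (F - h) 0 = deriv F 0 - deriv h 0 :=
    deriv_sub (hF.differentiableAt hnhds) (hh.differentiableAt hnhds)
  have h3 : deriv (-g) 0 = 0 := by rw [deriv.neg, hg', neg_zero]
  rw [h2, h3, mul_zero, add_zero] at h1
  rw [← h1, ← smul_eq_mul, ← Real.circleAverage_fun_smul]
  have cF := hF.continuousOn.mono hsub
  have ch := hh.continuousOn.mono hsub
  have cg := hg.continuousOn.mono hsub
  have cc : ContinuousOn (fun z => conj (g z)) (sphere 0 1) :=
    Complex.continuous_conj.comp_continuousOn cg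
  have cz : Continuous (fun z : ℂ => conj z) := Complex.continuous_conj
  have e : ∀ z, (F - h) z + conj ((-g) z) = F z - (h z + conj (g z)) := fun z => by
    simp only [Pi.sub_apply, Pi.neg_apply, map_neg]
    ring
  simp only [e]
  refine Real.circleAverage_mono ?_ ?_ fun z hz => ?_
  · exact ContinuousOn.circleIntegrable zero_le_one (by fun_prop)
  · exact ContinuousOn.circleIntegrable zero_le_one
      (Complex.continuous_re.comp_continuousOn (by fun_prop))
  · have hz1 : ‖z‖ = 1 := by simpa using hz
    exact hS z _ hz1 (hmaps z hz1)

/-- A map on the open disc need not have boundary values, so f(rz) replaces f(z). Its parts are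
holomorphic on the disc of radius 1/r > 1, at the cost of a factor r in the derivative. -/
lemma IsSupported.circleAverage_dilate_norm_sq_le (hS : IsSupported a lam κ F D) (hR : 1 < R)
    (hF : DifferentiableOn ℂ F (ball 0 R)) (hF0 : F 0 = 0) {h g : ℂ → ℂ}
    (hh : DifferentiableOn ℂ h (ball 0 1)) (hg : DifferentiableOn ℂ g (ball 0 1))
    (h0 : h 0 = 0) (g0 : g 0 = 0) (hg' : deriv g 0 = 0)
    (hmaps : ∀ z ∈ ball (0 : ℂ) 1, h z + conj (g z) ∈ D) {r : ℝ} (hr : r ∈ Set.Ioo 0 1) :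
    κ * Real.circleAverage (fun z => ‖F z - (h (r * z) + conj (g (r * z)))‖ ^ 2) 0 1
      ≤ (deriv F 0).re - r * (deriv h 0).re := by
  obtain ⟨hr0, hr1⟩ := hr
  have hmt : Set.MapsTo (fun z : ℂ => (r : ℂ) * z) (ball 0 (min R r⁻¹)) (ball 0 1) := by
    intro z hz
    have : ‖z‖ < r⁻¹ := (lt_min_iff.1 (by simpa using hz)).2
    simp only [mem_ball, dist_zero_right, norm_mul, Complex.norm_real, Real.norm_eq_abs,
      abs_of_pos hr0]
    calc r * ‖z‖ < r * r⁻¹ := by gcongr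
      _ = 1 := mul_inv_cancel₀ hr0.ne'
  have hdl : DifferentiableOn ℂ (fun z : ℂ => (r : ℂ) * z) (ball 0 (min R r⁻¹)) := by fun_prop
  have hnhds : ball (0 : ℂ) 1 ∈ nhds ((r : ℂ) * 0) := by
    rw [mul_zero]; exact ball_mem_nhds _ one_pos
  have hd : ∀ k : ℂ → ℂ, DifferentiableOn ℂ k (ball 0 1) →
      deriv (fun z => k (r * z)) 0 = r * deriv k 0 := by
    intro k hk
    have := (hk.differentiableAt hnhds).hasDerivAt.comp 0 ((hasDerivAt_id (0 : ℂ)).const_mul (r : ℂ))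
    rw [mul_comm, ← mul_one (r : ℂ)]
    simpa [Function.comp_def] using this.deriv
  have := hS.circleAverage_norm_sq_le (R := min R r⁻¹) (lt_min hR ((one_lt_inv₀ hr0).2 hr1))
    (hF.mono (ball_subset_ball (min_le_left _ _))) hF0 (h := fun z => h (r * z))
    (g := fun z => g (r * z)) (hh.comp hdl hmt) (hg.comp hdl hmt) (by simpa using h0)
    (by simpa using g0) (by rw [hd g hg, hg', mul_zero]) (fun z hz => hmaps _ (by
      simp [hz, abs_of_pos hr0, hr1]))
  rw [hd h hh] at this
  simpa using this

variable (hκ : 0 < κ) (hS : IsSupported a lam κ F D) (hR : 1 < R)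
  (hF : DifferentiableOn ℂ F (ball 0 R)) (hF0 : F 0 = 0) {h g : ℂ → ℂ}
  (hh : DifferentiableOn ℂ h (ball 0 1)) (hg : DifferentiableOn ℂ g (ball 0 1))
  (h0 : h 0 = 0) (g0 : g 0 = 0) (hg' : deriv g 0 = 0)
  (hmaps : ∀ z ∈ ball (0 : ℂ) 1, h z + conj (g z) ∈ D)
include hκ hS hR hF hF0 hh hg h0 g0 hg' hmaps

lemma IsSupported.re_deriv_le : (deriv h 0).re ≤ (deriv F 0).re := by
  have h1 : ∀ r ∈ Set.Ioo (0 : ℝ) 1, r * (deriv h 0).re ≤ (deriv F 0).re := fun r hr => by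
    have := hS.circleAverage_dilate_norm_sq_le hR hF hF0 hh hg h0 g0 hg' hmaps hr
    have h2 : 0 ≤ Real.circleAverage (fun z => ‖F z - (h (r * z) + conj (g (r * z)))‖ ^ 2) 0 1 :=
      Real.circleAverage_nonneg_of_nonneg fun _ _ => sq_nonneg _
    nlinarith [mul_nonneg hκ.le h2]
  have h3 : Filter.Tendsto (fun r : ℝ => r * (deriv h 0).re) (nhdsWithin 1 (Set.Iio 1))
      (nhds (1 * (deriv h 0).re)) :=
    ((continuous_id.mul continuous_const).tendsto 1).mono_left nhdsWithin_le_nhds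
  rw [one_mul] at h3
  refine le_of_tendsto h3 ?_
  filter_upwards [Ioo_mem_nhdsLT zero_lt_one] with r hr using h1 r hr

/-- In the equality case the mean square of F(z) - f(rz) on the circle is at most (1 - r) Re
F'(0)/κ. Subharmonicity turns this into a pointwise bound inside the disc, and r → 1 gives f = F. -/
lemma IsSupported.eqOn_of_re_deriv_eq (he : (deriv h 0).re = (deriv F 0).re) :
    ∀ z ∈ ball (0 : ℂ) 1, h z + conj (g z) = F z := by
  intro w hw
  have hw1 : ‖w‖ < 1 := by simpa using hw
  set C := (1 + ‖w‖) / (1 - ‖w‖) with hC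
  have hC0 : 0 ≤ C := div_nonneg (by positivity) (by linarith)
  have h1 : ∀ r ∈ Set.Ioo (0 : ℝ) 1, ‖F w - (h (r * w) + conj (g (r * w)))‖ ^ 2
      ≤ C * (((1 - r) * (deriv F 0).re) / κ) := fun r hr => by
    have h2 := hS.circleAverage_dilate_norm_sq_le hR hF hF0 hh hg h0 g0 hg' hmaps hr
    obtain ⟨hr0, hr1⟩ := hr
    rw [he] at h2
    have harm : HarmonicOnNhd (fun z => F z - (h (r * z) + conj (g (r * z))))
        (closedBall 0 1) := by
      have hmt : Set.MapsTo (fun z : ℂ => (r : ℂ) * z) (ball 0 r⁻¹) (ball 0 1) := by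
        intro z hz
        have : ‖z‖ < r⁻¹ := by simpa using hz
        simp only [mem_ball, dist_zero_right, norm_mul, Complex.norm_real, Real.norm_eq_abs,
          abs_of_pos hr0]
        calc r * ‖z‖ < r * r⁻¹ := by gcongr
          _ = 1 := mul_inv_cancel₀ hr0.ne'
      have hdl : DifferentiableOn ℂ (fun z : ℂ => (r : ℂ) * z) (ball 0 r⁻¹) := by fun_prop
      have ha : HarmonicOnNhd F (closedBall 0 1) := fun z hz =>
        (hF.analyticAt (isOpen_ball.mem_nhds (closedBall_subset_ball hR hz))).harmonicAt
      exact ha.sub ((harmonicOnNhd_add_conj isOpen_ball (hh.comp hdl hmt) (hg.comp hdl hmt)).mono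
        (closedBall_subset_ball ((one_lt_inv₀ hr0).2 hr1)))
    refine (harm.norm_sq_le_circleAverage hw).trans (mul_le_mul_of_nonneg_left ?_ hC0)
    rw [le_div_iff₀ hκ]
    linarith
  have hcont : ContinuousAt (fun z => h z + conj (g z)) w :=
    ((hh.continuousOn.continuousAt (isOpen_ball.mem_nhds hw)).add
      (Complex.continuous_conj.continuousAt.comp
        (hg.continuousOn.continuousAt (isOpen_ball.mem_nhds hw))))
  have hl : Filter.Tendsto (fun r : ℝ => (r : ℂ) * w) (nhdsWithin 1 (Set.Iio 1)) (nhds w) := by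
    have : Continuous fun r : ℝ => (r : ℂ) * w := by fun_prop
    simpa using (this.tendsto 1).mono_left nhdsWithin_le_nhds
  have l1 : Filter.Tendsto (fun r : ℝ => ‖F w - (h (r * w) + conj (g (r * w)))‖ ^ 2)
      (nhdsWithin 1 (Set.Iio 1)) (nhds (‖F w - (h w + conj (g w))‖ ^ 2)) :=
    ((tendsto_const_nhds.sub (hcont.tendsto.comp hl)).norm).pow 2
  have l2 : Filter.Tendsto (fun r : ℝ => C * (((1 - r) * (deriv F 0).re) / κ))
      (nhdsWithin 1 (Set.Iio 1)) (nhds 0) := by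
    have : Continuous fun r : ℝ => C * (((1 - r) * (deriv F 0).re) / κ) := by fun_prop
    simpa using (this.tendsto 1).mono_left nhdsWithin_le_nhds
  have h3 := le_of_tendsto_of_tendsto l1 l2 (by
    filter_upwards [Ioo_mem_nhdsLT zero_lt_one] with r hr using h1 r hr)
  have h4 : ‖F w - (h w + conj (g w))‖ = 0 := by
    nlinarith [norm_nonneg (F w - (h w + conj (g w)))]
  exact (sub_eq_zero.1 (norm_eq_zero.1 h4)).symm

end Extremal

/-! ### Explicit models of the image domain -/

/-- `F` is the primitive of `c / q` on a disc of radius `R > 1`, with holomorphic left inverse `G`,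
and its image of the unit disc is the sublevel set `ρ < 0` in the convex set `V` of a function `ρ`
that is convex on `V` and strongly convex where `ρ ≤ 0`. -/
structure IsConvexModel (q : ℂ → ℂ) (c : ℝ) (F G : ℂ → ℂ) (ρ : ℂ → ℝ) (V : Set ℂ)
    (κ R : ℝ) : Prop where
  one_lt : 1 < R
  kappa_pos : 0 < κ
  map_zero : F 0 = 0
  ne_zero : ∀ z ∈ ball (0 : ℂ) R, q z ≠ 0
  hasDerivAt : ∀ z ∈ ball (0 : ℂ) R, HasDerivAt F (c / q z) z
  defining_eq : ∀ z ∈ ball (0 : ℂ) R, ρ (F z) = c ^ 2 * (‖z‖ ^ 2 - 1) / ‖q z‖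
  mem : ∀ z ∈ closedBall (0 : ℂ) 1, F z ∈ V
  surj : ∀ w ∈ V, ρ w < 0 → ∃ z ∈ ball (0 : ℂ) 1, F z = w
  left_inv : ∀ z ∈ closedBall (0 : ℂ) 1, G (F z) = z
  differentiableAt_inv : ∀ z ∈ closedBall (0 : ℂ) 1, DifferentiableAt ℂ G (F z)
  isOpen : IsOpen V
  convex : Convex ℝ V
  contDiff : ContDiff ℝ 2 ρ
  hess_nonneg : ∀ w ∈ V, ∀ v, 0 ≤ fderiv ℝ (fderiv ℝ ρ) w v v
  hess_ge : ∀ w, ρ w ≤ 0 → ∀ v, κ * ‖v‖ ^ 2 ≤ fderiv ℝ (fderiv ℝ ρ) w v v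

lemma exists_one_lt_norm_mul_lt_one {α β : ℂ} (hα : ‖α‖ < 1) (hβ : ‖β‖ < 1) :
    ∃ R : ℝ, 1 < R ∧ ∀ z ∈ ball (0 : ℂ) R, ‖α * z‖ < 1 ∧ ‖β * z‖ < 1 := by
  set m := max ‖α‖ ‖β‖ with hm
  have hm0 : 0 ≤ m := (norm_nonneg α).trans (le_max_left _ _)
  have hm1 : m < 1 := max_lt hα hβ
  refine ⟨2 / (1 + m), by rw [lt_div_iff₀ (by linarith)]; linarith, fun z hz => ?_⟩
  have hz' : ‖z‖ < 2 / (1 + m) := by simpa using hz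
  rw [lt_div_iff₀ (by linarith)] at hz'
  have key : ∀ γ : ℂ, ‖γ‖ ≤ m → ‖γ * z‖ < 1 := fun γ hγ => by
    rw [norm_mul]
    nlinarith [norm_nonneg z, norm_nonneg γ, mul_le_mul_of_nonneg_right hγ (norm_nonneg z)]
  exact ⟨key α (le_max_left _ _), key β (le_max_right _ _)⟩

lemma one_sub_ne_zero_of_norm_lt_one {w : ℂ} (hw : ‖w‖ < 1) : 1 - w ≠ 0 := fun h => by
  rw [← sub_eq_zero.1 h, norm_one] at hw
  exact lt_irrefl _ hw

lemma fderiv_fderiv_norm_sq_sub {α : ℂ} {c : ℝ} (w v : ℂ) :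
    fderiv ℝ (fderiv ℝ fun w : ℂ => ‖w‖ ^ 2 - ‖c + α * w‖ ^ 2) w v v
      = 2 * (1 - ‖α‖ ^ 2) * ‖v‖ ^ 2 := by
  have hc : ContDiff ℝ 2 fun w : ℂ => ‖w‖ ^ 2 - ‖c + α * w‖ ^ 2 := by
    have h1 : ContDiff ℝ 2 fun w : ℂ => (c : ℂ) + α * w := by fun_prop
    exact (contDiff_id.norm_sq ℝ).sub (h1.norm_sq ℝ)
  have e : ∀ t : ℝ, ‖w + t • v‖ ^ 2 - ‖c + α * (w + t • v)‖ ^ 2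
      = (1 - ‖α‖ ^ 2) * ‖v‖ ^ 2 * t ^ 2
        + 2 * ((w * conj v).re - ((c + α * w) * conj (α * v)).re) * t
        + (‖w‖ ^ 2 - ‖c + α * w‖ ^ 2) := fun t => by
    simp only [Complex.sq_norm, Complex.normSq_apply]
    simp
    ring
  refine hc.fderiv_fderiv_eq_of_line (φ := fun t => 2 * ((1 - ‖α‖ ^ 2) * ‖v‖ ^ 2) * t
    + 2 * ((w * conj v).re - ((c + α * w) * conj (α * v)).re)) (fun t => ?_) ?_
  · simp only [e]
    exact ((((hasDerivAt_pow 2 t).const_mul ((1 - ‖α‖ ^ 2) * ‖v‖ ^ 2)).add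
      ((hasDerivAt_id t).const_mul _)).add_const _).congr_deriv (by push_cast; ring)
  · exact (((hasDerivAt_id (0 : ℝ)).const_mul _).add_const _).congr_deriv (by ring)

/-- Here F(z) = cz/(1 - αz) has inverse w/(c + αw), so the image is |w| < |c + αw|. The difference
of squares has the constant Hessian 2(1 - |α|²)|v|², and V can be the whole plane. -/
lemma exists_isConvexModel_sq {α : ℂ} (hα : ‖α‖ < 1) {c : ℝ} (hc : 0 < c) :
    ∃ F G ρ V κ R, IsConvexModel (fun z => (1 - α * z) * (1 - α * z)) c F G ρ V κ R := by
  obtain ⟨R, hR, hball⟩ := exists_one_lt_norm_mul_lt_one hα hα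
  have hc' : (c : ℂ) ≠ 0 := by exact_mod_cast hc.ne'
  have hne : ∀ z ∈ ball (0 : ℂ) R, 1 - α * z ≠ 0 := fun z hz =>
    one_sub_ne_zero_of_norm_lt_one (hball z hz).1
  have hsub : closedBall (0 : ℂ) 1 ⊆ ball 0 R := closedBall_subset_ball hR
  have hden : ∀ z ∈ ball (0 : ℂ) R, c + α * (c * z / (1 - α * z)) = c / (1 - α * z) := by
    intro z hz
    have := hne z hz
    field_simp
    ring
  have hα2 : 0 < 1 - ‖α‖ ^ 2 := by nlinarith [norm_nonneg α]
  refine ⟨fun z => c * z / (1 - α * z), fun w => w / (c + α * w),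
    fun w => ‖w‖ ^ 2 - ‖c + α * w‖ ^ 2, Set.univ, 2 * (1 - ‖α‖ ^ 2), R, hR, by linarith, by simp,
    fun z hz => mul_ne_zero (hne z hz) (hne z hz), fun z hz => ?_, fun z hz => ?_, fun _ _ => trivial, fun w _ hw => ?_, fun z hz => ?_,
    fun z hz => ?_, isOpen_univ, convex_univ, ?_, fun w _ v => ?_, fun w _ v => ?_⟩
  · have h1 : HasDerivAt (fun z => 1 - α * z) (-α) z := by
      simpa using ((hasDerivAt_id z).const_mul α).const_sub 1
    have h2 : HasDerivAt (fun z => (c : ℂ) * z) c z := by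
      simpa using (hasDerivAt_id z).const_mul (c : ℂ)
    refine (h2.div h1 (hne z hz)).congr_deriv ?_
    have := hne z hz
    field_simp
    ring
  · rw [hden z hz]
    have : ‖1 - α * z‖ ≠ 0 := norm_ne_zero_iff.2 (hne z hz)
    rw [norm_div, norm_div, norm_mul, norm_mul, Complex.norm_real, Real.norm_eq_abs,
      abs_of_pos hc]
    field_simp
  · have hlt : ‖w‖ < ‖c + α * w‖ := by
      have : ‖w‖ ^ 2 < ‖c + α * w‖ ^ 2 := by linarith
      exact lt_of_pow_lt_pow_left₀ 2 (norm_nonneg _) this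
    have h0 : c + α * w ≠ 0 := norm_pos_iff.1 ((norm_nonneg _).trans_lt hlt)
    refine ⟨w / (c + α * w), ?_, ?_⟩
    · rw [mem_ball, dist_zero_right, norm_div]
      exact (div_lt_one ((norm_nonneg _).trans_lt hlt)).2 hlt
    · have h1 : 1 - α * (w / (c + α * w)) = c / (c + α * w) := by
        field_simp
        ring
      rw [h1]
      clear h1 hlt
      generalize (c : ℂ) + α * w = d at h0 ⊢
      field_simp
  · rw [hden z (hsub hz)]
    have := hne z (hsub hz)
    generalize 1 - α * z = d at this ⊢
    field_simp
  · have h0 : (c : ℂ) + α * (c * z / (1 - α * z)) ≠ 0 := by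
      rw [hden z (hsub hz)]
      exact div_ne_zero hc' (hne z (hsub hz))
    exact DifferentiableAt.div (by fun_prop) (by fun_prop) h0
  · have h1 : ContDiff ℝ 2 fun w : ℂ => (c : ℂ) + α * w := by fun_prop
    exact (contDiff_id.norm_sq ℝ).sub (h1.norm_sq ℝ)
  · rw [fderiv_fderiv_norm_sq_sub]
    positivity
  · rw [fderiv_fderiv_norm_sq_sub]

/-! ### The model for two distinct roots. -/

/-- `A e^x + B e^{-x} - 2 Re (γ e^{iy})`, where `x + i y = δ w`. -/
noncomputable def stripDefining (A B : ℝ) (γ δ w : ℂ) : ℝ :=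
  A * Real.exp (δ * w).re + B * Real.exp (-(δ * w).re)
    - 2 * (γ.re * Real.cos (δ * w).im - γ.im * Real.sin (δ * w).im)

section Strip

variable (A B : ℝ) (γ δ : ℂ)

lemma contDiff_mul_re_im : (ContDiff ℝ 2 fun w : ℂ => (δ * w).re) ∧
    ContDiff ℝ 2 fun w : ℂ => (δ * w).im := by
  have h : ContDiff ℝ 2 fun w : ℂ => δ * w := by fun_prop
  exact ⟨Complex.reCLM.contDiff.comp h, Complex.imCLM.contDiff.comp h⟩

lemma contDiff_stripDefining : ContDiff ℝ 2 (stripDefining A B γ δ) := by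
  obtain ⟨h1, h2⟩ := contDiff_mul_re_im δ
  unfold stripDefining
  have h3 := Real.contDiff_exp.comp h1
  have h4 := Real.contDiff_exp.comp h1.neg
  have h5 := Real.contDiff_cos.comp h2
  have h6 := Real.contDiff_sin.comp h2
  exact ((contDiff_const.mul h3).add (contDiff_const.mul h4)).sub
    (contDiff_const.mul ((contDiff_const.mul h5).sub (contDiff_const.mul h6)))

lemma fderiv_fderiv_stripDefining (w v : ℂ) :
    fderiv ℝ (fderiv ℝ (stripDefining A B γ δ)) w v v
      = (A * Real.exp (δ * w).re + B * Real.exp (-(δ * w).re)) * (δ * v).re ^ 2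
        + 2 * (γ.re * Real.cos (δ * w).im - γ.im * Real.sin (δ * w).im) * (δ * v).im ^ 2 := by
  set x := (δ * w).re with hx
  set y := (δ * w).im with hy
  set ξ := (δ * v).re with hξ
  set η := (δ * v).im with hη
  have ere : ∀ t : ℝ, (δ * (w + t • v)).re = x + t * ξ := fun t => by
    simp [hx, hξ]; ring
  have eim : ∀ t : ℝ, (δ * (w + t • v)).im = y + t * η := fun t => by
    simp [hy, hη]; ring
  have dx : ∀ t : ℝ, HasDerivAt (fun t : ℝ => x + t * ξ) ξ t := fun t => by
    simpa using ((hasDerivAt_id t).mul_const ξ).const_add x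
  have dy : ∀ t : ℝ, HasDerivAt (fun t : ℝ => y + t * η) η t := fun t => by
    simpa using ((hasDerivAt_id t).mul_const η).const_add y
  refine (contDiff_stripDefining A B γ δ).fderiv_fderiv_eq_of_line
    (φ := fun t => A * (Real.exp (x + t * ξ) * ξ) + B * (Real.exp (-(x + t * ξ)) * -ξ)
      - 2 * (γ.re * (-Real.sin (y + t * η) * η) - γ.im * (Real.cos (y + t * η) * η)))
    (fun t => ?_) ?_
  · unfold stripDefining
    simp only [ere, eim]
    exact ((((dx t).exp).const_mul A).add ((((dx t).neg).exp).const_mul B)).sub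
      (((((dy t).cos).const_mul γ.re).sub (((dy t).sin).const_mul γ.im)).const_mul 2)
  · have := (((((dx 0).exp).mul_const ξ).const_mul A).add
      (((((dx 0).neg).exp).mul_const (-ξ)).const_mul B)).sub
      ((((((((dy 0).sin).neg).mul_const η).const_mul γ.re).sub
        ((((dy 0).cos).mul_const η).const_mul γ.im)).const_mul 2))
    refine this.congr_deriv ?_
    simp only [zero_mul, add_zero, Pi.neg_apply]
    ring

/-- The cosine term, in polar form of `γ`. -/
lemma re_mul_cos_sub_im_mul_sin (y : ℝ) :
    γ.re * Real.cos y - γ.im * Real.sin y = ‖γ‖ * Real.cos (y + γ.arg) := by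
  rw [Real.cos_add]
  linear_combination -Real.cos y * Complex.norm_mul_cos_arg γ
    + Real.sin y * Complex.norm_mul_sin_arg γ

lemma stripDefining_mul_exp (w : ℂ) :
    stripDefining A B γ δ w * ‖Complex.exp (δ * w)‖
      = A * ‖Complex.exp (δ * w)‖ ^ 2 + B - 2 * (γ * Complex.exp (δ * w)).re := by
  have h : Real.exp (-(δ * w).re) * Real.exp (δ * w).re = 1 := by
    rw [← Real.exp_add, neg_add_cancel, Real.exp_zero]
  rw [Complex.norm_exp, Complex.mul_re γ, Complex.exp_re, Complex.exp_im, stripDefining]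
  linear_combination B * h

end Strip

lemma Complex.exp_log_sub_log {P Q : ℂ} (hP : P ≠ 0) (hQ : Q ≠ 0) :
    Complex.exp (Complex.log P - Complex.log Q) = P / Q := by
  rw [Complex.exp_sub, Complex.exp_log hP, Complex.exp_log hQ]

lemma one_sub_re_pos_of_norm_lt_one {w : ℂ} (hw : ‖w‖ < 1) : 0 < (1 - w).re := by
  have := (Complex.re_le_norm w).trans_lt hw
  simpa using this

/-- With e = exp(δw), the inverse of F is (e - 1)/(βe - α); the right side is negative exactly when
this has a nonzero denominator and modulus below 1. -/
lemma norm_sq_sub_norm_sq (α β e : ℂ) :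
    (1 - ‖β‖ ^ 2) * ‖e‖ ^ 2 + (1 - ‖α‖ ^ 2) - 2 * ((1 - β * conj α) * e).re
      = ‖e - 1‖ ^ 2 - ‖β * e - α‖ ^ 2 := by
  simp only [Complex.sq_norm, Complex.normSq_apply]
  simp
  ring

/-- F is log((1 - αz)/(1 - βz))/δ. Flipping the sign of the cosine term of ρ gives the coefficients
of its Hessian. Where ρ ≤ 0 that term is at least A e^x + B e^{-x} ≥ min A B, so the Hessian is
uniformly positive. Since ρ is periodic in y, a strip V on which the cosine is positive selects the
correct piece of ρ < 0. -/
lemma exists_isConvexModel_of_ne {α β : ℂ} (hα : ‖α‖ < 1) (hβ : ‖β‖ < 1) (hαβ : α ≠ β)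
    {c : ℝ} (hc : 0 < c) :
    ∃ F G ρ V κ R, IsConvexModel (fun z => (1 - α * z) * (1 - β * z)) c F G ρ V κ R := by
  obtain ⟨R, hR, hball⟩ := exists_one_lt_norm_mul_lt_one hα hβ
  have hc' : (c : ℂ) ≠ 0 := by exact_mod_cast hc.ne'
  have hba : β - α ≠ 0 := sub_ne_zero.2 hαβ.symm
  have hP : ∀ z ∈ ball (0 : ℂ) R, 1 - α * z ≠ 0 := fun z hz =>
    one_sub_ne_zero_of_norm_lt_one (hball z hz).1
  have hQ : ∀ z ∈ ball (0 : ℂ) R, 1 - β * z ≠ 0 := fun z hz =>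
    one_sub_ne_zero_of_norm_lt_one (hball z hz).2
  have hPre : ∀ z ∈ ball (0 : ℂ) R, 0 < (1 - α * z).re := fun z hz =>
    one_sub_re_pos_of_norm_lt_one (hball z hz).1
  have hQre : ∀ z ∈ ball (0 : ℂ) R, 0 < (1 - β * z).re := fun z hz =>
    one_sub_re_pos_of_norm_lt_one (hball z hz).2
  have hsub : closedBall (0 : ℂ) 1 ⊆ ball 0 R := closedBall_subset_ball hR
  set δ : ℂ := (β - α) / c with hδ
  have hδ0 : δ ≠ 0 := div_ne_zero hba hc'
  -- Normalization: k|β - α|² = c², as the formula for ρ(F z) requires.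
  set k : ℝ := 1 / ‖δ‖ ^ 2 with hk
  have hk0 : 0 < k := by positivity
  set A : ℝ := k * (1 - ‖β‖ ^ 2) with hA
  set B : ℝ := k * (1 - ‖α‖ ^ 2) with hB
  have hA0 : 0 < A := mul_pos hk0 (by nlinarith [norm_nonneg β])
  have hB0 : 0 < B := mul_pos hk0 (by nlinarith [norm_nonneg α])
  set γ : ℂ := k * (1 - β * conj α) with hγ
  have hγre : 0 < γ.re := by
    have h1 : ‖β * conj α‖ < 1 := by
      rw [norm_mul, Complex.norm_conj]
      nlinarith [norm_nonneg α, norm_nonneg β]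
    rw [hγ, Complex.re_ofReal_mul]
    exact mul_pos hk0 (one_sub_re_pos_of_norm_lt_one h1)
  have hγarg : |γ.arg| < Real.pi / 2 := Complex.abs_arg_lt_pi_div_two_iff.2 (Or.inl hγre)
  have hγ0 : 0 < ‖γ‖ := norm_pos_iff.2 fun h => by simp [h] at hγre
  set F : ℂ → ℂ := fun z => (Complex.log (1 - α * z) - Complex.log (1 - β * z)) / δ with hF
  have hδF : ∀ z, δ * F z = Complex.log (1 - α * z) - Complex.log (1 - β * z) := fun z =>
    mul_div_cancel₀ _ hδ0
  have hexp : ∀ z ∈ ball (0 : ℂ) R, Complex.exp (δ * F z) = (1 - α * z) / (1 - β * z) :=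
    fun z hz => by rw [hδF, Complex.exp_log_sub_log (hP z hz) (hQ z hz)]
  have hden : ∀ z ∈ ball (0 : ℂ) R, β * Complex.exp (δ * F z) - α = (β - α) / (1 - β * z) :=
    fun z hz => by
      rw [hexp z hz]
      have := hQ z hz
      field_simp
      ring
  have hnum : ∀ z ∈ ball (0 : ℂ) R, Complex.exp (δ * F z) - 1 = (β - α) * z / (1 - β * z) :=
    fun z hz => by
      rw [hexp z hz, div_sub_one (hQ z hz)]
      congr 1
      ring
  have hρ : ∀ w, stripDefining A B γ δ w * ‖Complex.exp (δ * w)‖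
      = k * (‖Complex.exp (δ * w) - 1‖ ^ 2 - ‖β * Complex.exp (δ * w) - α‖ ^ 2) := fun w => by
    rw [stripDefining_mul_exp, ← norm_sq_sub_norm_sq, hγ, mul_assoc (k : ℂ),
      Complex.re_ofReal_mul, hA, hB]
    ring
  have hdef : ∀ z ∈ ball (0 : ℂ) R, stripDefining A B γ δ (F z)
      = c ^ 2 * (‖z‖ ^ 2 - 1) / ‖(1 - α * z) * (1 - β * z)‖ := fun z hz => by
    have h1 := hρ (F z)
    rw [hnum z hz, hden z hz, hexp z hz] at h1
    have h2 : ‖1 - α * z‖ ≠ 0 := norm_ne_zero_iff.2 (hP z hz)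
    have h3 : ‖1 - β * z‖ ≠ 0 := norm_ne_zero_iff.2 (hQ z hz)
    have h4 : ‖β - α‖ ≠ 0 := norm_ne_zero_iff.2 hba
    simp only [norm_div, norm_mul, hk, hδ, Complex.norm_real, Real.norm_eq_abs, abs_of_pos hc]
      at h1 ⊢
    field_simp at h1 ⊢
    linear_combination h1
  have hpos : ∀ w, min A B ≤ A * Real.exp (δ * w).re + B * Real.exp (-(δ * w).re) := fun w => by
    rcases le_total 0 (δ * w).re with h | h
    · have := Real.one_le_exp h
      have := Real.exp_pos (-(δ * w).re)
      nlinarith [min_le_left A B, mul_pos hB0 this]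
    · have := Real.one_le_exp (neg_nonneg.2 h)
      have := Real.exp_pos (δ * w).re
      nlinarith [min_le_right A B, mul_pos hA0 this]
  have hmin : 0 < min A B := lt_min hA0 hB0
  have hcos : ∀ w, stripDefining A B γ δ w ≤ 0 →
      min A B ≤ 2 * (γ.re * Real.cos (δ * w).im - γ.im * Real.sin (δ * w).im) := fun w hw => by
    have := hpos w
    unfold stripDefining at hw
    linarith
  have hstrip : ∀ z ∈ closedBall (0 : ℂ) 1, |(δ * F z).im + γ.arg| < Real.pi / 2 := fun z hz => by
    have hz' := hsub hz
    have hz1 : ‖z‖ ≤ 1 := by simpa using hz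
    have h1 : stripDefining A B γ δ (F z) ≤ 0 := by
      rw [hdef z hz']
      refine div_nonpos_of_nonpos_of_nonneg ?_ (norm_nonneg _)
      nlinarith [norm_nonneg z, sq_nonneg c, pow_le_one₀ (n := 2) (norm_nonneg z) hz1]
    have h2 := hcos _ h1
    rw [re_mul_cos_sub_im_mul_sin] at h2
    have h3 : 0 < Real.cos ((δ * F z).im + γ.arg) := by
      by_contra! h
      nlinarith
    -- Three arguments, each below π/2 in modulus. The cosine is nonpositive between π/2 and 3π/2,
    -- so its positivity leaves only the central strip.
    have h4 : |(δ * F z).im + γ.arg| ≤ Real.pi + Real.pi / 2 := by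
      rw [hδF, Complex.sub_im, Complex.log_im, Complex.log_im]
      have h5 := Complex.abs_arg_lt_pi_div_two_iff.2 (Or.inl (hPre z hz'))
      have h6 := Complex.abs_arg_lt_pi_div_two_iff.2 (Or.inl (hQre z hz'))
      rw [abs_lt] at h5 h6 hγarg
      rw [abs_le]
      constructor <;> linarith [h5.1, h5.2, h6.1, h6.2, hγarg.1, hγarg.2]
    by_contra h
    rw [← Real.cos_abs] at h3
    exact absurd h3 (Real.cos_nonpos_of_pi_div_two_le_of_le (not_lt.1 h) h4).not_gt
  refine ⟨F, fun w => (Complex.exp (δ * w) - 1) / (β * Complex.exp (δ * w) - α),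
    stripDefining A B γ δ, {w | |(δ * w).im + γ.arg| < Real.pi / 2}, min A B * ‖δ‖ ^ 2, R,
    hR, by positivity, by simp [hF],
    fun z hz => mul_ne_zero (hP z hz) (hQ z hz), fun z hz => ?_, hdef, fun z hz => hstrip z hz,
    fun w hw hneg => ?_, fun z hz => ?_, fun z hz => ?_, ?_, ?_,
    contDiff_stripDefining _ _ _ _, fun w hw v => ?_, fun w hw v => ?_⟩
  · have h1 : ∀ γ : ℂ, HasDerivAt (fun z => 1 - γ * z) (-γ) z := fun γ => by
      simpa using ((hasDerivAt_id z).const_mul γ).const_sub 1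
    have h2 := (((h1 α).clog (Or.inl (hPre z hz))).sub
      ((h1 β).clog (Or.inl (hQre z hz)))).div_const δ
    refine h2.congr_deriv ?_
    rw [div_sub_div _ _ (hP z hz) (hQ z hz), hδ,
      show -α * (1 - β * z) - (1 - α * z) * -β = β - α by ring]
    have h3 := mul_ne_zero (hP z hz) (hQ z hz)
    generalize (1 - α * z) * (1 - β * z) = d at h3 ⊢
    field_simp
  · set e := Complex.exp (δ * w) with he
    have he0 : e ≠ 0 := Complex.exp_ne_zero _
    have hlt : ‖e - 1‖ < ‖β * e - α‖ := by
      have h1 := hρ w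
      have h2 : stripDefining A B γ δ w * ‖e‖ < 0 := mul_neg_of_neg_of_pos hneg (norm_pos_iff.2 he0)
      rw [h1] at h2
      have h3 : ‖e - 1‖ ^ 2 < ‖β * e - α‖ ^ 2 := by
        by_contra! h
        nlinarith [mul_nonneg hk0.le (sub_nonneg.2 h)]
      exact lt_of_pow_lt_pow_left₀ 2 (norm_nonneg _) h3
    have hd0 : β * e - α ≠ 0 := norm_pos_iff.1 ((norm_nonneg _).trans_lt hlt)
    have hz : (e - 1) / (β * e - α) ∈ ball (0 : ℂ) 1 := by
      rw [mem_ball, dist_zero_right, norm_div]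
      exact (div_lt_one ((norm_nonneg _).trans_lt hlt)).2 hlt
    refine ⟨_, hz, ?_⟩
    have hz' := hstrip _ (ball_subset_closedBall hz)
    have h1 := hexp _ (hsub (ball_subset_closedBall hz))
    have h2 : 1 - α * ((e - 1) / (β * e - α)) = (β - α) * e / (β * e - α) := by
      rw [mul_div_assoc', one_sub_div hd0]
      congr 1
      ring
    have h3 : 1 - β * ((e - 1) / (β * e - α)) = (β - α) / (β * e - α) := by
      rw [mul_div_assoc', one_sub_div hd0]
      congr 1
      ring
    rw [h2, h3, div_div_div_cancel_right₀ hd0, mul_div_cancel_left₀ _ hba, he] at h1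
    set z := (Complex.exp (δ * w) - 1) / (β * Complex.exp (δ * w) - α)
    -- The exponential determines δw up to 2πin; both points lie in a strip of width π, hence n = 0.
    obtain ⟨n, hn⟩ := Complex.exp_eq_exp_iff_exists_int.1 h1
    have him : (δ * F z).im = (δ * w).im + n * (2 * Real.pi) := by
      rw [hn]
      simp
    rw [him] at hz'
    have hw' : |(δ * w).im + γ.arg| < Real.pi / 2 := hw
    have hn0 : n = 0 := by
      rw [abs_lt] at hw' hz'
      have h4 : (n : ℝ) < 1 := by nlinarith [Real.pi_pos]
      have h5 : (-1 : ℝ) < n := by nlinarith [Real.pi_pos]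
      have h6 : n < 1 := by exact_mod_cast h4
      have h7 : -1 < n := by exact_mod_cast h5
      omega
    rw [hn0] at hn
    exact mul_left_cancel₀ hδ0 (by simpa using hn)
  · have := hQ z (hsub hz)
    rw [hnum z (hsub hz), hden z (hsub hz)]
    generalize 1 - β * z = d at this ⊢
    field_simp
  · have h0 : β * Complex.exp (δ * F z) - α ≠ 0 := by
      rw [hden z (hsub hz)]
      exact div_ne_zero hba (hQ z (hsub hz))
    exact DifferentiableAt.div (by fun_prop) (by fun_prop) h0
  · exact isOpen_lt (by fun_prop) continuous_const
  · have h1 : {w : ℂ | |(δ * w).im + γ.arg| < Real.pi / 2} =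
        (Complex.imCLM ∘L (ContinuousLinearMap.mul ℂ ℂ δ).restrictScalars ℝ).toLinearMap ⁻¹'
          Set.Ioo (-(Real.pi / 2) - γ.arg) (Real.pi / 2 - γ.arg) := by
      ext w
      simp only [Set.mem_ofPred_eq, Set.mem_preimage, Set.mem_Ioo, abs_lt]
      exact ⟨fun h => ⟨sub_lt_iff_lt_add.2 h.1, lt_sub_iff_add_lt.2 h.2⟩,
        fun h => ⟨sub_lt_iff_lt_add.1 h.1, lt_sub_iff_add_lt.1 h.2⟩⟩
    rw [h1]
    exact (convex_Ioo _ _).linear_preimage _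
  · rw [fderiv_fderiv_stripDefining, re_mul_cos_sub_im_mul_sin]
    have h1 : 0 ≤ Real.cos ((δ * w).im + γ.arg) :=
      Real.cos_nonneg_of_mem_Icc ⟨(abs_lt.1 hw).1.le, (abs_lt.1 hw).2.le⟩
    have h2 := hmin.le.trans (hpos w)
    positivity
  · rw [fderiv_fderiv_stripDefining]
    have h1 : ‖δ‖ ^ 2 * ‖v‖ ^ 2 = (δ * v).re ^ 2 + (δ * v).im ^ 2 := by
      rw [← mul_pow, ← norm_mul, Complex.sq_norm, Complex.normSq_apply]
      ring
    rw [mul_assoc, h1]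
    nlinarith [mul_le_mul_of_nonneg_right (hpos w) (sq_nonneg (δ * v).re),
      mul_le_mul_of_nonneg_right (hcos w hw) (sq_nonneg (δ * v).im)]

theorem exists_isConvexModel {α β : ℂ} (hα : ‖α‖ < 1) (hβ : ‖β‖ < 1) {c : ℝ} (hc : 0 < c) :
    ∃ F G ρ V κ R, IsConvexModel (fun z => (1 - α * z) * (1 - β * z)) c F G ρ V κ R := by
  rcases eq_or_ne α β with rfl | h
  · exact exists_isConvexModel_sq hα hc
  · exact exists_isConvexModel_of_ne hα hβ h hc

/-! ### Geometry of the image domain -/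

namespace IsConvexModel

variable {q : ℂ → ℂ} {c : ℝ} {F G : ℂ → ℂ} {ρ : ℂ → ℝ} {V : Set ℂ} {κ R : ℝ}
  (M : IsConvexModel q c F G ρ V κ R)
include M

lemma closedBall_subset : closedBall (0 : ℂ) 1 ⊆ ball 0 R := closedBall_subset_ball M.one_lt

lemma image_ball_eq (hc : 0 < c) : F '' ball 0 1 = {w ∈ V | ρ w < 0} := by
  ext w
  constructor
  · rintro ⟨z, hz, rfl⟩
    have hz' := M.closedBall_subset (ball_subset_closedBall hz)
    refine ⟨M.mem z (ball_subset_closedBall hz), ?_⟩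
    rw [M.defining_eq z hz']
    have hz1 : ‖z‖ < 1 := by simpa using hz
    refine div_neg_of_neg_of_pos ?_ (norm_pos_iff.2 (M.ne_zero z hz'))
    have : ‖z‖ ^ 2 < 1 := pow_lt_one₀ (norm_nonneg z) hz1 two_ne_zero
    nlinarith [pow_pos hc 2]
  · rintro ⟨hV, hw⟩
    exact M.surj w hV hw

lemma convexOn : ConvexOn ℝ V ρ :=
  M.contDiff.convexOn_of_fderiv_fderiv_nonneg M.convex M.hess_nonneg

lemma isOpen_image (hc : 0 < c) : IsOpen (F '' ball 0 1) := by
  rw [M.image_ball_eq hc]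
  exact M.isOpen.inter (isOpen_lt M.contDiff.continuous continuous_const)

lemma convex_image (hc : 0 < c) : Convex ℝ (F '' ball 0 1) := by
  rw [M.image_ball_eq hc]
  exact M.convexOn.convex_lt 0

lemma isCompact_image : IsCompact (F '' closedBall 0 1) :=
  (isCompact_closedBall 0 1).image_of_continuousOn fun z hz =>
    (M.hasDerivAt z (M.closedBall_subset hz)).continuousAt.continuousWithinAt

lemma frontier_image_subset (hc : 0 < c) : frontier (F '' ball 0 1) ⊆ F '' sphere 0 1 := by
  rw [(M.isOpen_image hc).frontier_eq]
  rintro w ⟨hw, hw'⟩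
  obtain ⟨z, hz, rfl⟩ := closure_minimal (Set.image_mono ball_subset_closedBall)
    M.isCompact_image.isClosed hw
  refine ⟨z, ?_, rfl⟩
  rw [← sphere_union_ball] at hz
  exact hz.resolve_right fun h => hw' ⟨z, h, rfl⟩

lemma defining_eq_zero {z : ℂ} (hz : ‖z‖ = 1) : ρ (F z) = 0 := by
  rw [M.defining_eq z (M.closedBall_subset (by simp [hz])), hz]
  simp

/-- Differentiate ρ(F z) = c²(|z|² - 1)/|q(z)|. On the circle the numerator vanishes, so only its
derivative contributes. -/
lemma fderiv_defining (hc : 0 < c) {z : ℂ} (hz : ‖z‖ = 1) (u : ℂ) :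
    fderiv ℝ ρ (F z) u = 2 * c / ‖q z‖ * (conj z * q z * u).re := by
  have hzR : z ∈ ball (0 : ℂ) R := M.closedBall_subset (by simp [hz])
  have hq := M.ne_zero z hzR
  have hqn : ‖q z‖ ≠ 0 := norm_ne_zero_iff.2 hq
  have hc' : (c : ℂ) ≠ 0 := by exact_mod_cast hc.ne'
  have hFd := M.hasDerivAt z hzR
  -- Chosen so that F'(z)v = u.
  set v : ℂ := q z * u / c with hv
  have hline : HasDerivAt (fun t : ℝ => z + t • v) v 0 := by
    simpa using ((hasDerivAt_id (0 : ℝ)).smul_const v).const_add z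
  have hz0 : z + (0 : ℝ) • v = z := by simp
  have h1 : HasDerivAt (fun t : ℝ => F (z + t • v)) u 0 := by
    have h2 : HasDerivAt F (c / q z) (z + (0 : ℝ) • v) := by rwa [hz0]
    refine (HasDerivAt.scomp (𝕜 := ℝ) (𝕜' := ℂ) (0 : ℝ) h2 hline).congr_deriv ?_
    rw [hv, smul_eq_mul]
    field_simp
  have h2 : HasDerivAt (fun t : ℝ => ρ (F (z + t • v))) (fderiv ℝ ρ (F z) u) 0 := by
    have h3 : HasFDerivAt ρ (fderiv ℝ ρ (F z)) (F (z + (0 : ℝ) • v)) := by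
      rw [hz0]
      exact (M.contDiff.differentiable (by norm_num) _).hasFDerivAt
    exact h3.comp_hasDerivAt (0 : ℝ) h1
  have hmem : ∀ᶠ t : ℝ in nhds 0, z + t • v ∈ ball (0 : ℂ) R := by
    have : ContinuousAt (fun t : ℝ => z + t • v) 0 := hline.continuousAt
    exact this.eventually_mem (by rw [hz0]; exact isOpen_ball.mem_nhds hzR)
  have h4 : HasDerivAt (fun t : ℝ => ρ (F (z + t • v)))
      (2 * (z * conj v).re * (c ^ 2 / ‖q z‖)) 0 := by
    have hs : HasDerivAt (fun t : ℝ => ‖z + t • v‖ ^ 2 - 1) (2 * (z * conj v).re) 0 := by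
      have e : (fun t : ℝ => ‖z + t • v‖ ^ 2 - 1)
          = fun t : ℝ => ‖v‖ ^ 2 * t ^ 2 + 2 * (z * conj v).re * t + (‖z‖ ^ 2 - 1) := by
        funext t
        simp only [Complex.sq_norm, Complex.normSq_apply]
        simp
        ring
      rw [e]
      exact ((((hasDerivAt_pow 2 (0 : ℝ)).const_mul _).add
        ((hasDerivAt_id (0 : ℝ)).const_mul _)).add_const _).congr_deriv (by simp)
    have hFa : AnalyticAt ℂ (deriv F) z := by
      have : DifferentiableOn ℂ F (ball 0 R) := fun w hw =>
        (M.hasDerivAt w hw).differentiableAt.differentiableWithinAt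
      exact (this.analyticAt (isOpen_ball.mem_nhds hzR)).deriv
    have hFne : deriv F z ≠ 0 := by
      rw [hFd.deriv]
      exact div_ne_zero hc' hq
    -- This is the factor c²/|q|; its derivative is multiplied by |z|² - 1 = 0, so differentiability
    -- suffices.
    have hg : DifferentiableAt ℝ (fun t : ℝ => c * ‖deriv F (z + t • v)‖) 0 := by
      have h5 : DifferentiableAt ℝ (deriv F) (z + (0 : ℝ) • v) := by
        rw [hz0]
        exact hFa.differentiableAt.restrictScalars ℝ
      have h6 : DifferentiableAt ℝ (fun t : ℝ => deriv F (z + t • v)) 0 :=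
        DifferentiableAt.comp (g := deriv F) (0 : ℝ) h5 hline.differentiableAt
      exact (h6.norm ℝ (by rwa [hz0])).const_mul c
    have h7 := hs.mul hg.hasDerivAt
    refine (h7.congr_of_eventuallyEq ?_).congr_deriv ?_
    · filter_upwards [hmem] with t ht
      rw [M.defining_eq _ ht, Pi.mul_apply, (M.hasDerivAt _ ht).deriv, norm_div,
        Complex.norm_real, Real.norm_eq_abs, abs_of_pos hc]
      ring
    · rw [hz0, hz, hFd.deriv, norm_div, Complex.norm_real, Real.norm_eq_abs, abs_of_pos hc]
      ring
  rw [h2.unique h4]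
  have h8 : (z * conj v).re = (conj z * q z * u).re / c := by
    rw [← Complex.conj_re (z * conj v), hv, ← Complex.div_ofReal_re]
    congr 1
    simp only [map_mul, Complex.conj_conj]
    ring
  rw [h8]
  field_simp

lemma isBoundedStronglyConvexDomain (hc : 0 < c) :
    IsBoundedStronglyConvexDomain (F '' ball 0 1) where
  isOpen := M.isOpen_image hc
  nonempty := ⟨F 0, 0, by simp, rfl⟩
  bounded := M.isCompact_image.isBounded.subset (Set.image_mono ball_subset_closedBall)
  convex := M.convex_image hc
  boundary := by
    refine ⟨V, ρ, M.isOpen, ?_, M.contDiff.contDiffOn, ?_, ?_⟩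
    · intro w hw
      obtain ⟨z, hz, rfl⟩ := M.frontier_image_subset hc hw
      exact M.mem z (sphere_subset_closedBall hz)
    · rw [M.image_ball_eq hc]
      exact Set.inter_eq_left.2 fun w hw => hw.1
    · intro w hw
      obtain ⟨z, hz, rfl⟩ := M.frontier_image_subset hc hw
      have hz1 : ‖z‖ = 1 := by simpa using hz
      have hq := M.ne_zero z (M.closedBall_subset (sphere_subset_closedBall hz))
      have hqn : 0 < ‖q z‖ := norm_pos_iff.2 hq
      refine ⟨fun h => ?_, fun v hv _ => ?_⟩
      -- The outer normal direction, along which the derivative is positive.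
      · have h1 := M.fderiv_defining hc hz1 (z * conj (q z))
        have h2 : conj z * q z * (z * conj (q z)) = ((‖z‖ ^ 2 * ‖q z‖ ^ 2 : ℝ) : ℂ) := by
          push_cast
          rw [← Complex.mul_conj', ← Complex.mul_conj']
          ring
        rw [h, h2, Complex.ofReal_re, hz1] at h1
        have h3 : 0 < 2 * c / ‖q z‖ * (1 ^ 2 * ‖q z‖ ^ 2) := by positivity
        rw [← h1] at h3
        simp at h3
      · have := M.hess_ge _ (M.defining_eq_zero hz1).le v
        exact lt_of_lt_of_le (mul_pos M.kappa_pos (pow_pos (norm_pos_iff.2 hv) 2)) this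

/-- The segment from F z to w stays in ρ ≤ 0, where the Hessian is at least κ. The second order
tangent inequality at F z, with ρ(F z) = 0 > ρ(w), is then rescaled by |q|/(2c). -/
lemma support_le (hc : 0 < c) {z w : ℂ} (hz : ‖z‖ = 1) (hw : w ∈ F '' ball 0 1) :
    κ * ‖q z‖ / (4 * c) * ‖F z - w‖ ^ 2 ≤ (conj z * q z * (F z - w)).re := by
  rw [M.image_ball_eq hc] at hw
  have hzc : z ∈ closedBall (0 : ℂ) 1 := by simp [hz]
  have hqn : 0 < ‖q z‖ := norm_pos_iff.2 (M.ne_zero z (M.closedBall_subset hzc))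
  have h1 := M.contDiff.tangent_le (κ := κ) (p := F z) (v := w - F z) fun t ht => by
    apply M.hess_ge
    have hle := M.convexOn.convex_le 0
    exact (hle.add_smul_sub_mem ⟨M.mem z hzc, (M.defining_eq_zero hz).le⟩ ⟨hw.1, hw.2.le⟩ ht).2
  rw [M.defining_eq_zero hz, M.fderiv_defining hc hz, add_sub_cancel, norm_sub_rev,
    ← neg_sub (F z) w, mul_neg, Complex.neg_re] at h1
  have h2 := hw.2
  set X := (conj z * q z * (F z - w)).re
  have h3 : κ / 2 * ‖F z - w‖ ^ 2 ≤ 2 * c / ‖q z‖ * X := by linarith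
  have h4 := mul_le_mul_of_nonneg_left h3 (a := ‖q z‖ / (2 * c)) (by positivity)
  calc κ * ‖q z‖ / (4 * c) * ‖F z - w‖ ^ 2
      = ‖q z‖ / (2 * c) * (κ / 2 * ‖F z - w‖ ^ 2) := by field_simp; ring
    _ ≤ ‖q z‖ / (2 * c) * (2 * c / ‖q z‖ * X) := h4
    _ = X := by field_simp

end IsConvexModel

/-- On the circle z̄q(z) = z̄ + a + λz, and the minimum of |q| there makes the constant uniform. -/
lemma IsConvexModel.exists_isSupported {a lam : ℂ} {c : ℝ} {F G : ℂ → ℂ} {ρ : ℂ → ℝ} {V : Set ℂ}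
    {κ R : ℝ} (M : IsConvexModel (fun z => 1 + a * z + lam * z ^ 2) c F G ρ V κ R) (hc : 0 < c) :
    ∃ κ', 0 < κ' ∧ IsSupported a lam κ' F (F '' ball 0 1) := by
  have hcont : ContinuousOn (fun z : ℂ => ‖1 + a * z + lam * z ^ 2‖) (sphere 0 1) := by fun_prop
  obtain ⟨z₀, hz₀, hmin⟩ := (isCompact_sphere (0 : ℂ) 1).exists_isMinOn
    ⟨1, by simp⟩ hcont
  have hpos := norm_pos_iff.2 (M.ne_zero z₀ (M.closedBall_subset (sphere_subset_closedBall hz₀)))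
  have hκ := M.kappa_pos
  refine ⟨κ * ‖1 + a * z₀ + lam * z₀ ^ 2‖ / (4 * c), by positivity, fun z w hz hw => ?_⟩
  have h1 := M.support_le hc hz hw
  have h2 : ‖1 + a * z₀ + lam * z₀ ^ 2‖ ≤ ‖1 + a * z + lam * z ^ 2‖ :=
    hmin (show z ∈ sphere (0 : ℂ) 1 by simpa using hz)
  have h3 : conj z * (1 + a * z + lam * z ^ 2) = conj z + a + lam * z := by
    have hzz : conj z * z = 1 := by rw [Complex.conj_mul', hz]; simp
    linear_combination (a + lam * z) * hzz
  rw [h3] at h1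
  refine le_trans ?_ h1
  gcongr

/-! ### Admissible maps -/

lemma isConformalLinear_of_eq_mul {A : ℂ →L[ℝ] ℂ} {b : ℂ}
    (h : (∀ v, A v = b * v) ∨ ∀ v, A v = b * conj v) : IsConformalLinear A ∧ ‖A‖ = ‖b‖ := by
  constructor
  · by_cases hA : A = 0
    · exact Or.inr hA
    · refine Or.inl (isConformalMap_iff_is_complex_or_conj_linear.2 ⟨?_, hA⟩)
      refine h.imp (fun h => ⟨b • ContinuousLinearMap.id ℂ ℂ, ?_⟩)
        fun h => ⟨b • ContinuousLinearMap.id ℂ ℂ, ?_⟩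
      · ext v; simp [h]
      · ext v; simp [h]
  · refine A.homothety_norm fun v => ?_
    rcases h with h | h <;> simp [h]

lemma eq_zero_or_eq_zero_of_isConformalLinear {A : ℂ →L[ℝ] ℂ} {s t : ℂ}
    (h : ∀ v, A v = s * v + conj (t * v)) (hA : IsConformalLinear A) : t = 0 ∨ s = 0 := by
  have h1 := h 1
  have hI := h Complex.I
  simp only [map_mul, mul_one, Complex.conj_I] at h1 hI
  have main : A Complex.I = Complex.I * A 1 ∨ A Complex.I = -(Complex.I * A 1) := by
    rcases hA with hA | hA
    · refine (isConformalMap_iff_is_complex_or_conj_linear.1 hA).1.imp ?_ ?_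
      · rintro ⟨L, rfl⟩
        have := L.map_smul Complex.I 1
        simpa using this
      · rintro ⟨L, hL⟩
        have h2 : ∀ v, L v = A (conj v) := fun v => DFunLike.congr_fun hL v
        -- Since L is A after conjugation, L(-i) = A(i), which yields A(i) = -iA(1).
        have := L.map_smul (-Complex.I) 1
        simpa [h2] using this
    · simp [hA]
  rw [h1, hI] at main
  refine main.imp (fun e => ?_) fun e => ?_
  · have : conj t = 0 := mul_left_cancel₀ Complex.I_ne_zero (by linear_combination (-1 / 2) * e)
    simpa using this
  · exact mul_left_cancel₀ Complex.I_ne_zero (by linear_combination (1 / 2) * e)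

lemma fderiv_apply_of_eq_add_conj {f h g : ℂ → ℂ} (hh : DifferentiableOn ℂ h (ball 0 1))
    (hg : DifferentiableOn ℂ g (ball 0 1)) (hf : ∀ z ∈ ball (0 : ℂ) 1, f z = h z + conj (g z))
    (v : ℂ) : fderiv ℝ f 0 v = deriv h 0 * v + conj (deriv g 0 * v) := by
  have hn : ball (0 : ℂ) 1 ∈ nhds 0 := ball_mem_nhds _ one_pos
  have h1 := (hh.differentiableAt hn).hasDerivAt.hasFDerivAt.restrictScalars ℝ
  have h2 := (hg.differentiableAt hn).hasDerivAt.hasFDerivAt.restrictScalars ℝ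
  have h3 := h1.add ((Complex.conjCLE : ℂ →L[ℝ] ℂ).hasFDerivAt.comp (0 : ℂ) h2)
  have h4 := h3.congr_of_eventuallyEq (f₁ := f) (by
    filter_upwards [hn] with z hz
    simpa using hf z hz)
  rw [h4.fderiv]
  simp [mul_comm]

lemma differentiableOn_conj_conj_ball {h : ℂ → ℂ} (hh : DifferentiableOn ℂ h (ball 0 1)) :
    DifferentiableOn ℂ (fun z => conj (h (conj z))) (ball 0 1) ∧
      deriv (fun z => conj (h (conj z))) 0 = conj (deriv h 0) := by
  have key : ∀ z ∈ ball (0 : ℂ) 1, HasDerivAt (fun z => conj (h (conj z)))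
      (conj (deriv h (conj z))) z := fun z hz => by
    have hz' : conj z ∈ ball (0 : ℂ) 1 := by simpa using hz
    have := (hh.differentiableAt (isOpen_ball.mem_nhds hz')).hasDerivAt.conj_conj
    simpa [Function.comp_def] using this
  exact ⟨fun z hz => (key z hz).differentiableAt.differentiableWithinAt,
    by simpa using (key 0 (mem_ball_self one_pos)).deriv⟩

/-- Up to composition with the conjugation, an admissible map is `h + ḡ` with `g' 0 = 0`. -/
lemma IsAdmissible.exists_eq {D : Set ℂ} {f : ℂ → ℂ} (hf : IsAdmissible D 0 f) :
    ∃ h g : ℂ → ℂ, DifferentiableOn ℂ h (ball 0 1) ∧ DifferentiableOn ℂ g (ball 0 1) ∧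
      h 0 = 0 ∧ g 0 = 0 ∧ deriv g 0 = 0 ∧ ‖fderiv ℝ f 0‖ = ‖deriv h 0‖ ∧
      (∀ z ∈ ball (0 : ℂ) 1, h z + conj (g z) ∈ D) ∧
      ((∀ z ∈ ball (0 : ℂ) 1, f z = h z + conj (g z)) ∨
        ∀ z ∈ ball (0 : ℂ) 1, f z = h (conj z) + conj (g (conj z))) := by
  have hharm : HarmonicOnNhd f (ball 0 1) := hf.harmonic
  have hmaps : Set.MapsTo f (ball 0 1) D := hf.mapsTo
  obtain ⟨h, g, hh, hg, h0, g0, e⟩ := hharm.exists_add_conj hf.map_zero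
  have hA := fderiv_apply_of_eq_add_conj hh hg e
  rcases eq_zero_or_eq_zero_of_isConformalLinear hA hf.conformal with hs | hs
  · refine ⟨h, g, hh, hg, h0, g0, hs, ?_, fun z hz => e z hz ▸ hmaps hz, Or.inl e⟩
    exact (isConformalLinear_of_eq_mul (Or.inl fun v => by simp [hA, hs])).2
  · obtain ⟨dh, dh0⟩ := differentiableOn_conj_conj_ball hh
    obtain ⟨dg, dg0⟩ := differentiableOn_conj_conj_ball hg
    -- Orientation reversing case: passing to f(z̄) exchanges the holomorphic and antiholomorphic
    -- parts.
    refine ⟨fun z => conj (g (conj z)), fun z => conj (h (conj z)), dg, dh, by simp [g0],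
      by simp [h0], dh0.trans (by simp [hs]), ?_, fun z hz => ?_, Or.inr fun z hz => ?_⟩
    · rw [dg0]
      exact (isConformalLinear_of_eq_mul (Or.inr fun v => by simp [hA, hs])).2
    · have hz' : conj z ∈ ball (0 : ℂ) 1 := by simpa using hz
      rw [Complex.conj_conj, add_comm, ← e _ hz']
      exact hmaps hz'
    · rw [e z hz]
      simp [add_comm]

lemma isAdmissible_of_holomorphic {D : Set ℂ} {f h : ℂ → ℂ}
    (hh : DifferentiableOn ℂ h (ball 0 1)) (h0 : h 0 = 0) (hmaps : Set.MapsTo h (ball 0 1) D)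
    (hf : Set.EqOn f h (ball 0 1) ∨ Set.EqOn f (fun z => h (conj z)) (ball 0 1)) :
    IsAdmissible D 0 f ∧ ‖fderiv ℝ f 0‖ = ‖deriv h 0‖ := by
  have hmem : (0 : ℂ) ∈ ball (0 : ℂ) 1 := mem_ball_self one_pos
  have harm : ∀ k l : ℂ → ℂ, DifferentiableOn ℂ k (ball 0 1) → DifferentiableOn ℂ l (ball 0 1) →
      (∀ z ∈ ball (0 : ℂ) 1, f z = k z + conj (l z)) → HarmonicOnNhd f (ball 0 1) :=
    fun k l hk hl e z hz => (harmonicAt_congr_nhds (by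
      filter_upwards [isOpen_ball.mem_nhds hz] with w hw using e w hw)).2
      (harmonicOnNhd_add_conj isOpen_ball hk hl z hz)
  have d0 : DifferentiableOn ℂ (fun _ : ℂ => (0 : ℂ)) (ball 0 1) := by fun_prop
  rcases hf with hf | hf
  · have e : ∀ z ∈ ball (0 : ℂ) 1, f z = h z + conj ((fun _ => 0 : ℂ → ℂ) z) := fun z hz => by
      simpa using hf hz
    obtain ⟨hc, hn⟩ := isConformalLinear_of_eq_mul (A := fderiv ℝ f 0) (b := deriv h 0)
      (Or.inl fun v => by simp [fderiv_apply_of_eq_add_conj hh d0 e v])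
    exact ⟨⟨harm _ _ hh d0 e, fun z hz => hf hz ▸ hmaps hz, (hf hmem).trans h0, hc⟩, hn⟩
  · obtain ⟨dh, dh0⟩ := differentiableOn_conj_conj_ball hh
    have e : ∀ z ∈ ball (0 : ℂ) 1,
        f z = (fun _ => 0 : ℂ → ℂ) z + conj ((fun z => conj (h (conj z))) z) := fun z hz => by
      simpa using hf hz
    obtain ⟨hc, hn⟩ := isConformalLinear_of_eq_mul (A := fderiv ℝ f 0) (b := deriv h 0)
      (Or.inr fun v => by simp [fderiv_apply_of_eq_add_conj d0 dh e v, dh0])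
    refine ⟨⟨harm _ _ d0 dh e, fun z hz => ?_, ?_, hc⟩, hn⟩
    · rw [hf hz]
      exact hmaps (by simpa [unitDisc] using hz)
    · rw [hf hmem]
      simpa using h0

section Rotation

variable {a lam : ℂ} {c κ R : ℝ} {F : ℂ → ℂ} {D : Set ℂ} (hκ : 0 < κ)
  (hS : IsSupported a lam κ F D) (hR : 1 < R) (hF : DifferentiableOn ℂ F (ball 0 R))
  (hF0 : F 0 = 0) (hF' : deriv F 0 = c) {h g : ℂ → ℂ}
  (hh : DifferentiableOn ℂ h (ball 0 1)) (hg : DifferentiableOn ℂ g (ball 0 1))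
  (h0 : h 0 = 0) (g0 : g 0 = 0) (hg' : deriv g 0 = 0)
  (hmaps : ∀ z ∈ ball (0 : ℂ) 1, h z + conj (g z) ∈ D)
include hκ hS hR hF hF0 hF' hh hg h0 g0 hg' hmaps

/-- Rotating the variable by minus the argument of h'(0) makes the derivative real and nonnegative,
so bounds on real parts become bounds on moduli. Only the source is rotated; D needs no symmetry. -/
lemma IsSupported.norm_deriv_le_and_eq : ‖deriv h 0‖ ≤ c ∧ (‖deriv h 0‖ = c →
    ∃ θ : ℝ, ∀ z ∈ ball (0 : ℂ) 1, h z + conj (g z) = F (Complex.exp (θ * Complex.I) * z)) := by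
  set θ := (deriv h 0).arg with hθ
  set u := Complex.exp (-(θ * Complex.I)) with hu
  have hu1 : ‖u‖ = 1 := by
    rw [hu, ← neg_mul, ← Complex.ofReal_neg, Complex.norm_exp_ofReal_mul_I]
  have hinv : u * Complex.exp (θ * Complex.I) = 1 := by
    rw [hu, ← Complex.exp_add, neg_add_cancel, Complex.exp_zero]
  have hmt : Set.MapsTo (fun z : ℂ => u * z) (ball 0 1) (ball 0 1) := fun z hz => by
    simpa [hu1] using hz
  have hdl : DifferentiableOn ℂ (fun z : ℂ => u * z) (ball 0 1) := by fun_prop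
  have hn : ball (0 : ℂ) 1 ∈ nhds (u * 0) := by
    rw [mul_zero]
    exact ball_mem_nhds _ one_pos
  have hd : ∀ k : ℂ → ℂ, DifferentiableOn ℂ k (ball 0 1) →
      deriv (fun z => k (u * z)) 0 = deriv k 0 * u := by
    intro k hk
    have := (hk.differentiableAt hn).hasDerivAt.comp 0 ((hasDerivAt_id (0 : ℂ)).const_mul u)
    simpa [Function.comp_def] using this.deriv
  have hre : (deriv (fun z => h (u * z)) 0).re = ‖deriv h 0‖ := by
    rw [hd h hh]
    have h1 := Complex.norm_mul_exp_arg_mul_I (deriv h 0)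
    have h2 : deriv h 0 * u = ‖deriv h 0‖ := by
      rw [← hθ] at h1
      linear_combination (-u) * h1 + ‖deriv h 0‖ * hinv
    rw [h2, Complex.ofReal_re]
  have hcre : (deriv F 0).re = c := by rw [hF', Complex.ofReal_re]
  have dh : DifferentiableOn ℂ (fun z => h (u * z)) (ball 0 1) := hh.comp hdl hmt
  have dg : DifferentiableOn ℂ (fun z => g (u * z)) (ball 0 1) := hg.comp hdl hmt
  have dg' : deriv (fun z => g (u * z)) 0 = 0 := by rw [hd g hg, hg', zero_mul]
  constructor
  · have := hS.re_deriv_le hκ hR hF hF0 dh dg (by simpa using h0) (by simpa using g0) dg'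
      (fun z hz => hmaps _ (hmt hz))
    rwa [hre, hcre] at this
  · intro he
    have := hS.eqOn_of_re_deriv_eq hκ hR hF hF0 dh dg (by simpa using h0) (by simpa using g0) dg'
      (fun z hz => hmaps _ (hmt hz)) (by rw [hre, hcre, he])
    refine ⟨θ, fun z hz => ?_⟩
    have hz' : Complex.exp (θ * Complex.I) * z ∈ ball (0 : ℂ) 1 := by
      simpa [Complex.norm_exp_ofReal_mul_I] using hz
    have h1 := this _ hz'
    rwa [← mul_assoc, hinv, one_mul] at h1

end Rotation

/-! ### Existence and uniqueness of the primitive, and the main theorem. -/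

lemma IsQuadraticPrimitive.exists {a lam : ℂ} (c : ℝ)
    (hq : ∀ z : ℂ, ‖z‖ ≤ 1 → 1 + a * z + lam * z ^ 2 ≠ 0) :
    ∃ F : ℂ → ℂ, IsQuadraticPrimitive a lam c F := by
  have hd : DifferentiableOn ℂ (fun z : ℂ => (c : ℂ) / (1 + a * z + lam * z ^ 2)) (ball 0 1) :=
    DifferentiableOn.div (by fun_prop) (by fun_prop) fun z hz =>
      hq z (by simpa using (mem_ball_zero_iff.1 hz).le)
  obtain ⟨F, hF⟩ := hd.isExactOn_ball.with_val_at 0 0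
  exact ⟨F, hF.1, hF.2⟩

lemma IsQuadraticPrimitive.eqOn {a lam : ℂ} {c : ℝ} {F G : ℂ → ℂ}
    (hF : IsQuadraticPrimitive a lam c F) (hG : IsQuadraticPrimitive a lam c G) :
    Set.EqOn F G unitDisc :=
  isOpen_ball.eqOn_of_deriv_eq (convex_ball (0 : ℂ) 1).isPreconnected
    (fun z hz => (hF.2 z hz).differentiableAt.differentiableWithinAt)
    (fun z hz => (hG.2 z hz).differentiableAt.differentiableWithinAt)
    (fun z hz => (hF.2 z hz).deriv.trans (hG.2 z hz).deriv.symm)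
    (mem_ball_self one_pos) (hF.1.trans hG.1.symm)

lemma IsQuadraticPrimitive.deriv_zero {a lam : ℂ} {c : ℝ} {F : ℂ → ℂ}
    (hF : IsQuadraticPrimitive a lam c F) : deriv F 0 = c := by
  simpa using (hF.2 0 (mem_ball_self one_pos)).deriv

theorem theorem1p1 (a lam : ℂ) :
    -- the Schur--Cohn criterion
    ((∀ z : ℂ, ‖z‖ ≤ 1 → 1 + a * z + lam * z ^ 2 ≠ 0) ↔
      (‖lam‖ < 1 ∧ ‖a - conj a * lam‖ < 1 - ‖lam‖ ^ 2)) ∧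
    ((∀ z : ℂ, ‖z‖ ≤ 1 → 1 + a * z + lam * z ^ 2 ≠ 0) → ∀ c : ℝ, 0 < c →
      -- `F` exists and is unique on the disc
      (∃ F : ℂ → ℂ, IsQuadraticPrimitive a lam c F) ∧
      (∀ F G : ℂ → ℂ, IsQuadraticPrimitive a lam c F → IsQuadraticPrimitive a lam c G →
        Set.EqOn F G unitDisc) ∧
      ∀ F : ℂ → ℂ, IsQuadraticPrimitive a lam c F →
        IsBiholomorphicOnto F unitDisc (F '' unitDisc) ∧
        IsBoundedStronglyConvexDomain (F '' unitDisc) ∧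
        harmonicM (F '' unitDisc) 0 = ENNReal.ofReal ‖deriv F 0‖ ∧
        ‖deriv F 0‖ = c ∧
        ∀ f : ℂ → ℂ, IsHarmonicExtremal (F '' unitDisc) 0 f ↔
          ∃ θ : ℝ,
            Set.EqOn f (fun z => F (Complex.exp (θ * Complex.I) * z)) unitDisc ∨
            Set.EqOn f (fun z => F (Complex.exp (θ * Complex.I) * conj z)) unitDisc) := by
  obtain ⟨α, β, ha, hlam⟩ := exists_eq_mul_one_sub a lam
  have hfac : ∀ z, 1 + a * z + lam * z ^ 2 = (1 - α * z) * (1 - β * z) := fun z => by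
    rw [ha, hlam]
    ring
  refine ⟨?_, fun hq c hc => ⟨IsQuadraticPrimitive.exists c hq, fun F G hF hG => hF.eqOn hG,
    fun F hF => ?_⟩⟩
  · simp only [hfac]
    rw [forall_one_sub_mul_ne_zero_iff, ha, hlam]
    exact schurCohn_roots_iff α β
  obtain ⟨hα, hβ⟩ := (forall_one_sub_mul_ne_zero_iff α β).1 (by simpa only [hfac] using hq)
  obtain ⟨F₀, G, ρ, V, κ, R, M⟩ := exists_isConvexModel hα hβ hc
  simp only [← hfac] at M
  have hprim : IsQuadraticPrimitive a lam c F₀ := ⟨M.map_zero, fun z hz =>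
    M.hasDerivAt z (M.closedBall_subset (ball_subset_closedBall hz))⟩
  -- F is prescribed only on the open disc, whereas the model F₀ is holomorphic past the circle;
  -- boundary arguments use F₀ and are transferred through this equality.
  have heq : Set.EqOn F F₀ (ball 0 1) := hF.eqOn hprim
  have himg : F '' unitDisc = F₀ '' ball 0 1 := heq.image_eq
  have hdF : ‖deriv F 0‖ = c := by
    rw [hF.deriv_zero, Complex.norm_real, Real.norm_eq_abs, abs_of_pos hc]
  obtain ⟨κ', hκ', hS⟩ := M.exists_isSupported hc
  have hF₀ : DifferentiableOn ℂ F₀ (ball 0 R) := fun z hz =>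
    (M.hasDerivAt z hz).differentiableAt.differentiableWithinAt
  have hFd : DifferentiableOn ℂ F (ball 0 1) := fun z hz =>
    (hF.2 z hz).differentiableAt.differentiableWithinAt
  have bound : ∀ f, IsAdmissible (F '' unitDisc) 0 f → ‖fderiv ℝ f 0‖ ≤ c ∧
      (‖fderiv ℝ f 0‖ = c → ∃ θ : ℝ,
        Set.EqOn f (fun z => F (Complex.exp (θ * Complex.I) * z)) unitDisc ∨
        Set.EqOn f (fun z => F (Complex.exp (θ * Complex.I) * conj z)) unitDisc) := by
    intro f hf
    obtain ⟨h, g, hh, hg, h0, g0, hg', hnorm, hmaps, hfe⟩ := hf.exists_eq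
    rw [himg] at hmaps
    obtain ⟨hle, hthen⟩ := hS.norm_deriv_le_and_eq hκ' M.one_lt hF₀ M.map_zero
      hprim.deriv_zero hh hg h0 g0 hg' hmaps
    rw [hnorm]
    refine ⟨hle, fun he => ?_⟩
    obtain ⟨θ, hθ⟩ := hthen he
    have hrot : ∀ z ∈ ball (0 : ℂ) 1, Complex.exp (θ * Complex.I) * z ∈ ball (0 : ℂ) 1 :=
      fun z hz => by simpa [Complex.norm_exp_ofReal_mul_I] using hz
    refine ⟨θ, hfe.imp (fun e z hz => ?_) fun e z hz => ?_⟩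
    · rw [e z hz, hθ z hz, ← heq (hrot z hz)]
    · have hz' : conj z ∈ ball (0 : ℂ) 1 := by simpa [unitDisc] using hz
      rw [e z hz, hθ _ hz', ← heq (hrot _ hz')]
  have conv : ∀ f : ℂ → ℂ, (∃ θ : ℝ,
      Set.EqOn f (fun z => F (Complex.exp (θ * Complex.I) * z)) unitDisc ∨
      Set.EqOn f (fun z => F (Complex.exp (θ * Complex.I) * conj z)) unitDisc) →
      IsAdmissible (F '' unitDisc) 0 f ∧ ‖fderiv ℝ f 0‖ = c := by
    rintro f ⟨θ, hf⟩
    set u := Complex.exp (θ * Complex.I) with hu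
    have hu1 : ‖u‖ = 1 := Complex.norm_exp_ofReal_mul_I θ
    have hmt : Set.MapsTo (fun z : ℂ => u * z) (ball 0 1) (ball 0 1) := fun z hz => by
      simpa [hu1] using hz
    have hdl : DifferentiableOn ℂ (fun z : ℂ => u * z) (ball 0 1) := by fun_prop
    have hder : deriv (fun z => F (u * z)) 0 = deriv F 0 * u := by
      have h1 : DifferentiableAt ℂ F (u * 0) := by
        rw [mul_zero]
        exact hFd.differentiableAt (ball_mem_nhds _ one_pos)
      have := h1.hasDerivAt.comp 0 ((hasDerivAt_id (0 : ℂ)).const_mul u)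
      simpa [Function.comp_def] using this.deriv
    have := isAdmissible_of_holomorphic (D := F '' unitDisc) (f := f) (h := fun z => F (u * z))
      (hFd.comp hdl hmt) (by simpa using hF.1) (fun z hz => ⟨_, hmt hz, rfl⟩) hf
    rwa [hder, norm_mul, hu1, mul_one, hdF] at this
  have hM : harmonicM (F '' unitDisc) 0 = ENNReal.ofReal c := by
    refine le_antisymm (iSup₂_le fun f hf => ?_) ?_
    · rw [← ofReal_norm]
      exact ENNReal.ofReal_le_ofReal (bound f hf).1
    -- The supremum is attained by F itself, the case θ = 0.
    · obtain ⟨h1, h2⟩ := conv F ⟨0, Or.inl fun z _ => by simp⟩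
      rw [← h2, ofReal_norm]
      exact le_iSup₂ (f := fun (f : ℂ → ℂ) (_ : IsAdmissible (F '' unitDisc) 0 f) =>
        ‖fderiv ℝ f 0‖ₑ) F h1
  refine ⟨?_, ?_, by rw [hM, hdF], hdF, fun f => ⟨fun hf => ?_, fun hf => ?_⟩⟩
  · refine ⟨isOpen_ball, himg ▸ M.isOpen_image hc, hFd, Set.mapsTo_image _ _, G, ?_, ?_, ?_, ?_⟩
    · rw [himg]
      rintro _ ⟨z, hz, rfl⟩
      exact (M.differentiableAt_inv z (ball_subset_closedBall hz)).differentiableWithinAt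
    · rw [himg]
      rintro _ ⟨z, hz, rfl⟩
      rw [M.left_inv z (ball_subset_closedBall hz)]
      exact hz
    · intro z hz
      rw [heq hz, M.left_inv z (ball_subset_closedBall hz)]
    · rintro _ ⟨z, hz, rfl⟩
      rw [heq hz, M.left_inv z (ball_subset_closedBall hz), heq hz]
  · rw [himg]
    exact M.isBoundedStronglyConvexDomain hc
  · refine (bound f hf.1).2 ?_
    have h1 := hf.2
    rw [hM, ← ofReal_norm, ENNReal.ofReal_eq_ofReal_iff (norm_nonneg _) hc.le] at h1
    exact h1
  · obtain ⟨h1, h2⟩ := conv f hf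
    exact ⟨h1, by rw [hM, ← h2, ofReal_norm]⟩
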